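/- An alphabet is a finite nonempty set. A (multi-valued partial) function $f$ maps $\Sigma^*$ to the power set $\mathcal P(\Gamma^*)$ for some alphabets $\Sigma,\Gamma$; it is single-valued if $|f(x)|\le 1$ for all $x$. Consider one-way one-head nondeterministic pushdown automata (npda's) that allow $\lambda$-moves, read an input $x\in\Sigma^*$ enclosed in two endmarkers, are equipped with a write-only output tape over $\Gamma$ (at most one output symbol is written per step), and all of whose computation paths reach a halting (accepting or rejecting) state within $O(n)$ steps on inputs of length $n$. Let $\mathrm{CFLMV}$ be the class of all functions $f:\Sigma^*\to\mathcal P(\Gamma^*)$ for which there is such an npda $N$ such that, for every $x\in\Sigma^*$, $f(x)$ is the set of all strings produced on the output tape along accepting computation paths of $N$ on $x$. Let $\mathrm{CFLSV}$ be the class of all single-valued functions in $\mathrm{CFLMV}$. For classes $\mathcal F,\mathcal G$ of functions, let $\mathcal F\wedge\mathcal G$ (resp. $\mathcal F\vee\mathcal G$) be the class of all functions $x\mapsto f(x)\cap g(x)$ (resp. $x\mapsto f(x)\cup g(x)$) with $f\in\mathcal F$ and $g\in\mathcal G$ over common alphabets. Put $\mathrm{CFLMV}(1)=\mathrm{CFLMV}$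 and $\mathrm{CFLMV}(k+1)=\mathrm{CFLMV}(k)\wedge\mathrm{CFLMV}$, and define $\mathrm{CFLSV}(k)$ in the same way from $\mathrm{CFLSV}$. **Proposition.** Let $k,m\ge 1$. 1. $\mathrm{CFLMV}(\max\{k,m\})\subseteq \mathrm{CFLMV}(k)\vee\mathrm{CFLMV}(m)\subseteq\mathrm{CFLMV}(km)$. 2. $\mathrm{CFLMV}(\max\{k,m\})\subseteq \mathrm{CFLMV}(k)\wedge\mathrm{CFLMV}(m)\subseteq\mathrm{CFLMV}(k+m)$. 3. $\mathrm{CFLSV}(k)\subsetneq\mathrm{CFLSV}(k+1)$. -/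

import Mathlib

/-- The symbols that can occur on an input tape over the alphabet `A`: the left endmarker, the
letters of `A`, and the right endmarker. -/
inductive TapeSym (A : Type) : Type
  | left : TapeSym A
  | letter : A → TapeSym A
  | right : TapeSym A

/-- A one-way one-head nondeterministic pushdown automaton with lambda-moves and with a write-only
output tape; `A` is the input alphabet and `B` the output alphabet.  A transition depends on the
inner state, on the input symbol read (`none` for a lambda-move) and on the top stack symbol; it
gives the new state, the string that replaces the top stack symbol (its first letter becomes the
new top), and the symbol written on the output tape (`none` if nothing is written).
The transition function is used only at states that are not halting. -/
structure NPDA (A B : Type) where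
  Q : Type
  stackSym : Type
  finite_Q : Finite Q
  finite_stackSym : Finite stackSym
  δ : Q → Option (TapeSym A) → stackSym → Finset (Q × List stackSym × Option B)
  q₀ : Q
  Z₀ : stackSym
  acc : Set Q
  rej : Set Q
  disjoint_acc_rej : Disjoint acc rej

namespace NPDA

variable {A B : Type}

/-- A configuration: inner state, unread part of the input tape, stack (top first), and the string
written so far on the output tape. -/
structure Config (M : NPDA A B) where
  state : M.Q
  input : List (TapeSym A)
  stack : List M.stackSym
  output : List B

/-- The set of halting states. -/
def halt (M : NPDA A B) : Set M.Q := M.acc ∪ M.rej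

/-- The initial configuration on `x`: the input tape holds `x` between the two endmarkers. -/
def init (M : NPDA A B) (x : List A) : M.Config :=
  ⟨M.q₀, TapeSym.left :: (x.map TapeSym.letter ++ [TapeSym.right]), [M.Z₀], []⟩

/-- One step of the machine. -/
inductive Step (M : NPDA A B) : M.Config → M.Config → Prop
  | read {q q' : M.Q} {a : TapeSym A} {w : List (TapeSym A)} {Z : M.stackSym}
      {s u : List M.stackSym} {o : List B} {b : Option B}
      (hq : q ∉ M.halt) (h : (q', u, b) ∈ M.δ q (some a) Z) :
      Step M ⟨q, a :: w, Z :: s, o⟩ ⟨q', w, u ++ s, o ++ b.toList⟩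
  | lam {q q' : M.Q} {w : List (TapeSym A)} {Z : M.stackSym}
      {s u : List M.stackSym} {o : List B} {b : Option B}
      (hq : q ∉ M.halt) (h : (q', u, b) ∈ M.δ q none Z) :
      Step M ⟨q, w, Z :: s, o⟩ ⟨q', w, u ++ s, o ++ b.toList⟩

/-- `M.StepsIn t c d`: some computation path leads from `c` to `d` in exactly `t` steps. -/
inductive StepsIn (M : NPDA A B) : ℕ → M.Config → M.Config → Prop
  | refl (c : M.Config) : StepsIn M 0 c c
  | tail {t : ℕ} {c d e : M.Config} (h : StepsIn M t c d) (hs : M.Step d e) :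
      StepsIn M (t + 1) c e

/-- The termination condition: on every input of length `n`, all computation paths reach a halting
state, and they do so within `O(n)` steps. -/
def Terminating (M : NPDA A B) : Prop :=
  ∃ C : ℕ, ∀ (x : List A) (t : ℕ) (d : M.Config), M.StepsIn t (M.init x) d →
    t ≤ C * (x.length + 1) ∧ ((∀ e, ¬ M.Step d e) → d.state ∈ M.halt)

/-- The set of valid outputs of `M` on `x`, i.e. those produced along an accepting path. -/
def validOutputs (M : NPDA A B) (x : List A) : Set (List B) :=
  {y | ∃ (t : ℕ) (d : M.Config), M.StepsIn t (M.init x) d ∧ d.state ∈ M.acc ∧ d.output = y}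

end NPDA

/-- A class of multi-valued partial functions: for each input alphabet `A` and each output
alphabet `B` (finite nonempty types) a set of functions from strings over `A` to sets of strings
over `B`. -/
def FunClass : Type 1 :=
  ∀ (A B : Type) [Finite A] [Nonempty A] [Finite B] [Nonempty B], Set (List A → Set (List B))

namespace FunClass

/-- Containment of classes: every function of `F`, over whatever alphabets, belongs to `G`. -/
instance : HasSubset FunClass where
  Subset F G := ∀ (A B : Type) [Finite A] [Nonempty A] [Finite B] [Nonempty B]
    (f : List A → Set (List B)), f ∈ F A B → f ∈ G A B

/-- Proper containment: containment, and some function of `G`, over some alphabets, is not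
in `F`. -/
instance : HasSSubset FunClass where
  SSubset F G := F ⊆ G ∧
    ∃ (A B : Type) (_ : Finite A) (_ : Nonempty A) (_ : Finite B) (_ : Nonempty B)
      (f : List A → Set (List B)), f ∈ G A B ∧ f ∉ F A B

/-- The class of all `x ↦ f₁ x ∩ f₂ x` with `f₁ ∈ F` and `f₂ ∈ G`. -/
def wedge (F G : FunClass) : FunClass := fun A B _ _ _ _ =>
  {f | ∃ f₁ ∈ F A B, ∃ f₂ ∈ G A B, ∀ x, f x = f₁ x ∩ f₂ x}

/-- The class of all `x ↦ f₁ x ∪ f₂ x` with `f₁ ∈ F` and `f₂ ∈ G`. -/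
def vee (F G : FunClass) : FunClass := fun A B _ _ _ _ =>
  {f | ∃ f₁ ∈ F A B, ∃ f₂ ∈ G A B, ∀ x, f x = f₁ x ∪ f₂ x}

/-- The `k`-conjunctive class `F(k)` for `k ≥ 1`: `F(1) = F` and `F(k+1) = F(k) ∧ F`.
(The value at `0` is not used.) -/
def conj (F : FunClass) : ℕ → FunClass
  | 0 => F
  | 1 => F
  | k + 2 => (conj F (k + 1)).wedge F

end FunClass

/-- The functions computed by terminating npda's with output tapes. -/
def baseCFLMV : FunClass := fun A B _ _ _ _ =>
  {f | ∃ M : NPDA A B, M.Terminating ∧ ∀ x, f x = M.validOutputs x}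

/-- The single-valued (partial) functions among them. -/
def baseCFLSV : FunClass := fun A B _ _ _ _ =>
  {f | f ∈ baseCFLMV A B ∧ ∀ x, (f x).Subsingleton}

/-- The `k`-conjunctive class of multi-valued CFL functions. -/
def CFLMV (k : ℕ) : FunClass := baseCFLMV.conj k

/-- The `k`-conjunctive class of single-valued CFL functions. -/
def CFLSV (k : ℕ) : FunClass := baseCFLSV.conj k

/-! Items 1 and 2 are set algebra. A function of `F.conj k` is an intersection of `k` functions of
`F`; a union of two such intersections distributes into `k * m` binary unions, and `choice` shows
that the base class is closed under union. For the lower inclusions, the missing operand is the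
empty function or a base function containing the given one.

The inclusion in item 3 is padding again. Its strictness is witnessed by `balance (k + 1)`: over
letters a_0, ..., a_k, b_0, ..., b_k it outputs the empty string exactly when each a_i occurs as
often as b_i. Each equation is checked by one counter (`compare`), so `k + 1` factors suffice.

That `k` factors do not suffice is seen on sorted words, which are determined by their Parikh
vectors. As in the Ginsburg-Spanier theory of bounded languages, the vectors of the sorted words on
which one machine can output the empty string form a finite union of linear sets with stratified
periods: at most two nonzero coordinates each, and no crossings (`NPDA.exists_linSets`). If `k`
factors had intersection `balance (k + 1)`, each diagonal vector (u, u) would lie in an intersection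
of `k` such linear sets, one per factor, and all these intersections would lie in the diagonal.
There are finitely many choices of linear sets, whereas each intersection contains only finitely
many points u = (t, t^2, ..., t^(k+1)) of the moment curve (`finite_setOf_momentPoint_mem`); this is
the contradiction.

For one choice, consider the orthogonal space of each period set. If one of its vectors gives a
nontrivial equation on the diagonal, that equation has finitely many solutions on the curve.
Otherwise stratification forces dimension at most one (`Stratified.orth_le_span`): the pairs (a_i,
b_i) cross one another, so they belong to one component. Then `k` conditions on `k + 1` unknowns
leave a nonzero w with (w, 0) in the rational span of every period set. A point lying deep in all
the linear sets could be moved by a multiple of (w, 0), off the diagonal. Hence some period is used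
boundedly often; it is removed, and induction applies. -/

/-! ### Derivation trees of commutative grammars -/

/-- A grammar whose words are commutative: leaves carry vectors, all other rules are binary. -/
structure VecGrammar (N ι : Type) where
  leaf : N → (ι → ℕ) → Prop
  bin : N → N → N → Prop
  leaf_le : ∀ {X v}, leaf X v → v ≤ 1

/-- Labelled binary trees. -/
inductive VTree (N ι : Type) : Type
  | leaf : N → (ι → ℕ) → VTree N ι
  | node : N → VTree N ι → VTree N ι → VTree N ι

namespace VTree

variable {N ι : Type}

def root : VTree N ι → N
  | leaf X _ => X
  | node X _ _ => X

def yield : VTree N ι → ι → ℕ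
  | leaf _ v => v
  | node _ s t => s.yield + t.yield

def labels : VTree N ι → Set N
  | leaf X _ => {X}
  | node X s t => insert X (s.labels ∪ t.labels)

def height : VTree N ι → ℕ
  | leaf _ _ => 0
  | node _ s t => max s.height t.height + 1

def size : VTree N ι → ℕ
  | leaf _ _ => 0
  | node _ s t => s.size + t.size + 1

def subtrees : VTree N ι → Set (VTree N ι)
  | leaf X v => {leaf X v}
  | node X s t => insert (node X s t) (s.subtrees ∪ t.subtrees)

def Valid (g : VecGrammar N ι) : VTree N ι → Prop
  | leaf X v => g.leaf X v
  | node X s t => g.bin X s.root t.root ∧ s.Valid g ∧ t.Valid g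

theorem root_mem_labels (t : VTree N ι) : t.root ∈ t.labels := by
  cases t <;> simp [root, labels]

theorem self_mem_subtrees (t : VTree N ι) : t ∈ t.subtrees := by
  cases t <;> simp [subtrees]

theorem labels_subset_of_mem_subtrees {s t : VTree N ι} (h : s ∈ t.subtrees) :
    s.labels ⊆ t.labels := by
  induction t with
  | leaf X v => simp only [subtrees, Set.mem_singleton_iff] at h; rw [h]
  | node X a b iha ihb =>
    simp only [subtrees, Set.mem_insert_iff, Set.mem_union] at h
    rcases h with rfl | h | h
    · exact subset_rfl
    · exact (iha h).trans (Set.subset_union_left.trans (Set.subset_insert _ _))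
    · exact (ihb h).trans (Set.subset_union_right.trans (Set.subset_insert _ _))

theorem size_le_of_mem_subtrees {s t : VTree N ι} (h : s ∈ t.subtrees) : s.size ≤ t.size := by
  induction t with
  | leaf X v => simp only [subtrees, Set.mem_singleton_iff] at h; rw [h]
  | node X a b iha ihb =>
    simp only [subtrees, Set.mem_insert_iff, Set.mem_union] at h
    rcases h with rfl | h | h
    · exact le_rfl
    · have := iha h; simp only [size]; omega
    · have := ihb h; simp only [size]; omega

theorem subtrees_subset_of_mem_subtrees {s t : VTree N ι} (h : s ∈ t.subtrees) :
    s.subtrees ⊆ t.subtrees := by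
  induction t with
  | leaf X v => simp only [subtrees, Set.mem_singleton_iff] at h; rw [h]
  | node X a b iha ihb =>
    simp only [subtrees, Set.mem_insert_iff, Set.mem_union] at h
    rcases h with rfl | h | h
    · exact subset_rfl
    · exact (iha h).trans (Set.subset_union_left.trans (Set.subset_insert _ _))
    · exact (ihb h).trans (Set.subset_union_right.trans (Set.subset_insert _ _))

theorem Valid.of_mem_subtrees {g : VecGrammar N ι} {s t : VTree N ι} (ht : t.Valid g)
    (h : s ∈ t.subtrees) : s.Valid g := by
  induction t with
  | leaf X v => simp only [subtrees, Set.mem_singleton_iff] at h; rw [h]; exact ht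
  | node X a b iha ihb =>
    simp only [subtrees, Set.mem_insert_iff, Set.mem_union] at h
    rcases h with rfl | h | h
    · exact ht
    · exact iha ht.2.1 h
    · exact ihb ht.2.2 h

theorem Valid.yield_le {g : VecGrammar N ι} {t : VTree N ι} (ht : t.Valid g) (i : ι) :
    t.yield i ≤ 2 ^ t.height := by
  induction t with
  | leaf X v => simpa [yield, height] using g.leaf_le ht i
  | node X a b iha ihb =>
    have h1 := (iha ht.2.1).trans
      (Nat.pow_le_pow_right two_pos (le_max_left a.height b.height))
    have h2 := (ihb ht.2.2).trans
      (Nat.pow_le_pow_right two_pos (le_max_right a.height b.height))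
    simp only [yield, height, Pi.add_apply, pow_succ]
    omega

end VTree

/-! ### Inserting and removing loops in derivation trees -/

namespace VecGrammar

variable {N ι : Type}

open VTree

/-- `g.Ctx X Y p`: a derivation leads from `X` to `Y` surrounded by terminals of total weight
`p`. -/
inductive Ctx (g : VecGrammar N ι) : N → N → (ι → ℕ) → Prop
  | refl (X : N) : Ctx g X X 0
  | left {X Y Z : N} {p : ι → ℕ} {t : VTree N ι} (hb : g.bin X Y t.root) (ht : t.Valid g)
      (h : Ctx g Y Z p) : Ctx g X Z (p + t.yield)
  | right {X Y Z : N} {p : ι → ℕ} {t : VTree N ι} (hb : g.bin X t.root Y) (ht : t.Valid g)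
      (h : Ctx g Y Z p) : Ctx g X Z (p + t.yield)

/-- The weights of the loops at the nonterminals in `U`. -/
def Pump (g : VecGrammar N ι) (U : Set N) (p : ι → ℕ) : Prop := ∃ X ∈ U, g.Ctx X X p

theorem Pump.mono {g : VecGrammar N ι} {U V : Set N} (h : U ⊆ V) {p : ι → ℕ} :
    g.Pump U p → g.Pump V p := fun ⟨X, hX, hp⟩ => ⟨X, h hX, hp⟩

theorem Ctx.plug {g : VecGrammar N ι} {X Y : N} {p : ι → ℕ} (h : g.Ctx X Y p) :
    ∀ {t : VTree N ι}, t.Valid g → t.root = Y →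
      ∃ t' : VTree N ι, t'.Valid g ∧ t'.root = X ∧ t'.yield = t.yield + p ∧
        t.labels ⊆ t'.labels := by
  induction h with
  | refl X => intro t ht hr; exact ⟨t, ht, hr, by simp, subset_rfl⟩
  | @left X Y Z p s hb hs _ ih =>
    intro t ht hr
    obtain ⟨t', h1, h2, h3, h4⟩ := ih ht hr
    refine ⟨.node X t' s, ⟨by rwa [h2], h1, hs⟩, rfl, ?_, ?_⟩
    · simp [yield, h3, add_assoc]
    · exact h4.trans (Set.subset_union_left.trans (Set.subset_insert _ _))
  | @right X Y Z p s hb hs _ ih =>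
    intro t ht hr
    obtain ⟨t', h1, h2, h3, h4⟩ := ih ht hr
    refine ⟨.node X s t', ⟨by rwa [h2], hs, h1⟩, rfl, ?_, ?_⟩
    · simp only [yield, h3]; abel
    · exact h4.trans (Set.subset_union_right.trans (Set.subset_insert _ _))

/-- The loop is inserted at an occurrence of `X`. No label is lost, so other loops can still be
inserted afterwards. -/
theorem exists_valid_add_pump {g : VecGrammar N ι} {X : N} {p : ι → ℕ} (hp : g.Ctx X X p)
    {t : VTree N ι} (ht : t.Valid g) (hX : X ∈ t.labels) :
    ∃ t' : VTree N ι, t'.Valid g ∧ t'.root = t.root ∧ t'.yield = t.yield + p ∧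
      t.labels ⊆ t'.labels := by
  by_cases hr : t.root = X
  · obtain ⟨t', h⟩ := hp.plug ht hr
    exact ⟨t', by rwa [hr]⟩
  induction t with
  | leaf Y v => exact absurd (Set.mem_singleton_iff.1 hX).symm hr
  | node Y a b iha ihb =>
    have root_eq : ∀ {s : VTree N ι}, s.Valid g → (s.root ≠ X → ∃ t' : VTree N ι,
        t'.Valid g ∧ t'.root = s.root ∧ t'.yield = s.yield + p ∧ s.labels ⊆ t'.labels) →
        ∃ t' : VTree N ι, t'.Valid g ∧ t'.root = s.root ∧ t'.yield = s.yield + p ∧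
          s.labels ⊆ t'.labels := by
      intro s hs h
      by_cases hr : s.root = X
      · obtain ⟨t', h⟩ := hp.plug hs hr
        exact ⟨t', by rwa [hr]⟩
      · exact h hr
    simp only [labels, Set.mem_insert_iff, Set.mem_union] at hX
    rcases hX with hX | hX | hX
    · exact absurd hX.symm hr
    · obtain ⟨t', h1, h2, h3, h4⟩ := root_eq ht.2.1 (iha ht.2.1 hX)
      refine ⟨.node Y t' b, ⟨by rw [h2]; exact ht.1, h1, ht.2.2⟩, rfl, ?_, ?_⟩
      · simp only [yield, h3]; abel
      · exact Set.insert_subset_insert (Set.union_subset_union_left _ h4)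
    · obtain ⟨t', h1, h2, h3, h4⟩ := root_eq ht.2.2 (ihb ht.2.2 hX)
      refine ⟨.node Y a t', ⟨by rw [h2]; exact ht.1, ht.2.1, h1⟩, rfl, ?_, ?_⟩
      · simp only [yield, h3]; abel
      · exact Set.insert_subset_insert (Set.union_subset_union_right _ h4)

theorem exists_ctx_of_mem_subtrees {g : VecGrammar N ι} {s t : VTree N ι} (ht : t.Valid g)
    (h : s ∈ t.subtrees) : ∃ p, g.Ctx t.root s.root p ∧ t.yield = s.yield + p := by
  induction t with
  | leaf X v =>
    simp only [subtrees, Set.mem_singleton_iff] at h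
    rw [h]; exact ⟨0, .refl _, by simp⟩
  | node X a b iha ihb =>
    simp only [subtrees, Set.mem_insert_iff, Set.mem_union] at h
    rcases h with rfl | h | h
    · exact ⟨0, .refl _, by simp⟩
    · obtain ⟨p, hp, e⟩ := iha ht.2.1 h
      exact ⟨_, .left ht.1 ht.2.2 hp, by simp only [yield, e]; abel⟩
    · obtain ⟨p, hp, e⟩ := ihb ht.2.2 h
      exact ⟨_, .right ht.1 ht.2.1 hp, by simp only [yield, e]; abel⟩

open scoped Classical in
/-- Removing loops until the height is bounded, while keeping the labels in `W`; the subtrees that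
carry all of `W` have no root in `F`. -/
theorem exists_valid_height_le [Fintype N] {g : VecGrammar N ι} (n : ℕ) :
    ∀ (t : VTree N ι), t.size = n → t.Valid g → ∀ (W F : Finset N), ↑W ⊆ t.labels →
      (∀ s ∈ t.subtrees, ↑W ⊆ s.labels → s.root ∉ F) →
      ∃ t' : VTree N ι, t'.Valid g ∧ t'.root = t.root ∧ ↑W ⊆ t'.labels ∧ t'.labels ⊆ t.labels ∧
        t'.height ≤ W.card * (Fintype.card N + 1) + (Fintype.card N - F.card) ∧
        ∃ p ∈ AddSubmonoid.closure {p | g.Pump t.labels p ∧ p ≤ t.yield}, t.yield = t'.yield + p := by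
  induction n using Nat.strong_induction_on with
  | _ n ih =>
  intro t hn ht W F hW hF
  cases t with
  | leaf X v =>
    exact ⟨.leaf X v, ht, rfl, hW, subset_rfl, by simp [height], 0, zero_mem _, by simp⟩
  | node X a b =>
  have pump_mono : ∀ {c : VTree N ι}, c ∈ (VTree.node X a b).subtrees → c.yield ≤ a.yield + b.yield →
      ∀ {p}, p ∈ AddSubmonoid.closure {p | g.Pump c.labels p ∧ p ≤ c.yield} →
      p ∈ AddSubmonoid.closure {p | g.Pump (VTree.node X a b).labels p ∧ p ≤ (VTree.node X a b).yield} := by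
    intro c hc hy p hp
    refine AddSubmonoid.closure_mono ?_ hp
    rintro p ⟨h1, h2⟩
    exact ⟨h1.mono (labels_subset_of_mem_subtrees hc), h2.trans hy⟩
  have ha : a ∈ (VTree.node X a b).subtrees := by
    simp [subtrees, self_mem_subtrees]
  have hb : b ∈ (VTree.node X a b).subtrees := by
    simp [subtrees, self_mem_subtrees]
  -- If the root label recurs below with all of `W` still present, the loop in between is cut out.
  -- Otherwise `X` may be added to `F` for the children.
  by_cases hs : ∃ s ∈ a.subtrees ∪ b.subtrees, s.root = X ∧ ↑W ⊆ s.labels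
  · obtain ⟨s, hs, hsX, hsW⟩ := hs
    have hst : s ∈ (VTree.node X a b).subtrees := Set.mem_insert_of_mem _ hs
    have hlt : s.size < n := by
      subst hn
      rcases hs with hs | hs
      · have := size_le_of_mem_subtrees hs; simp only [size]; omega
      · have := size_le_of_mem_subtrees hs; simp only [size]; omega
    obtain ⟨t', h1, h2, h3, h4, h5, p, hp, e⟩ := ih _ hlt s rfl (ht.of_mem_subtrees hst) W F hsW
      (fun r hr => hF r (subtrees_subset_of_mem_subtrees hst hr))
    obtain ⟨q, hq, eq⟩ := exists_ctx_of_mem_subtrees ht hst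
    have hsy : s.yield ≤ a.yield + b.yield := by
      have : a.yield + b.yield = s.yield + q := eq
      rw [this]; exact le_self_add
    refine ⟨t', h1, h2.trans hsX, h3, h4.trans (labels_subset_of_mem_subtrees hst), h5,
      p + q, add_mem (pump_mono hst hsy hp) (AddSubmonoid.subset_closure ⟨⟨X, ?_, ?_⟩, ?_⟩), ?_⟩
    · exact root_mem_labels (VTree.node X a b)
    · rwa [hsX] at hq
    · rw [eq]; exact le_add_self
    · rw [eq, e, add_assoc]
  · have hXF : X ∉ F := hF _ (self_mem_subtrees _) hW
    have hcard : F.card < Fintype.card N :=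
      Finset.card_lt_univ_of_notMem hXF
    have key : ∀ c : VTree N ι, (c = a ∨ c = b) → ∃ t' : VTree N ι, t'.Valid g ∧
        t'.root = c.root ∧ (∀ x ∈ W, x ∈ c.labels → x ∈ t'.labels) ∧ t'.labels ⊆ c.labels ∧
        t'.height + 1 ≤ W.card * (Fintype.card N + 1) + (Fintype.card N - F.card) ∧
        ∃ p ∈ AddSubmonoid.closure {p | g.Pump c.labels p ∧ p ≤ c.yield}, c.yield = t'.yield + p := by
      intro c hc
      have hct : c ∈ (VTree.node X a b).subtrees := by rcases hc with rfl | rfl <;> assumption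
      have hlt : c.size < n := by
        subst hn; rcases hc with rfl | rfl <;> simp only [size] <;> omega
      have hcs : c.subtrees ⊆ a.subtrees ∪ b.subtrees := by
        rcases hc with rfl | rfl
        · exact Set.subset_union_left
        · exact Set.subset_union_right
      -- The height bound is lexicographic: a child that keeps all of `W` enlarges `F`; a child that
      -- misses part of `W` has a smaller `W`, which pays for restarting with `F` empty.
      by_cases hWc : ∀ x ∈ W, x ∈ c.labels
      · obtain ⟨t', h1, h2, h3, h4, h5, h6⟩ := ih _ hlt c rfl (ht.of_mem_subtrees hct) W
          (insert X F) hWc (by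
            intro s hs1 hs2
            rw [Finset.mem_insert, not_or]
            exact ⟨fun h => hs ⟨s, hcs hs1, h, hs2⟩,
              hF s (subtrees_subset_of_mem_subtrees hct hs1) hs2⟩)
        refine ⟨t', h1, h2, fun x hx _ => h3 hx, h4, ?_, h6⟩
        rw [Finset.card_insert_of_notMem hXF] at h5
        omega
      · obtain ⟨t', h1, h2, h3, h4, h5, h6⟩ := ih _ hlt c rfl (ht.of_mem_subtrees hct)
          (W.filter (· ∈ c.labels)) ∅ (by intro x hx; simpa using (Finset.mem_filter.1 hx).2)
          (by simp)
        refine ⟨t', h1, h2, fun x hx hxc => h3 (by simp [hx, hxc]), h4, ?_, h6⟩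
        have hlt' : (W.filter (· ∈ c.labels)).card < W.card := by
          refine Finset.card_lt_card (Finset.filter_ssubset.2 ?_)
          push Not at hWc
          exact hWc
        have := Nat.mul_le_mul_right (Fintype.card N + 1) (Nat.succ_le_of_lt hlt')
        rw [Nat.succ_mul] at this
        simp only [Finset.card_empty] at h5
        omega
    obtain ⟨a', a1, a2, a3, a4, a5, p, hp, ep⟩ := key a (.inl rfl)
    obtain ⟨b', b1, b2, b3, b4, b5, q, hq, eq⟩ := key b (.inr rfl)
    refine ⟨.node X a' b', ⟨by rw [a2, b2]; exact ht.1, a1, b1⟩, rfl, ?_, ?_, ?_, p + q,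
      add_mem (pump_mono ha le_self_add hp) (pump_mono hb le_add_self hq), ?_⟩
    · intro x hx
      rcases hW hx with h | h | h
      · exact .inl h
      · exact .inr (.inl (a3 x hx h))
      · exact .inr (.inr (b3 x hx h))
    · exact Set.insert_subset_insert (Set.union_subset_union a4 b4)
    · simp only [height]; omega
    · simp only [yield, ep, eq]; abel

/-- Every tree is obtained from a tree of bounded height with the same labels by inserting bounded
loops. -/
theorem exists_valid_labels_eq [Fintype N] {g : VecGrammar N ι} {H : ℕ}
    (hH : H = Fintype.card N * (Fintype.card N + 1) + Fintype.card N)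
    {t : VTree N ι} (ht : t.Valid g) :
    ∃ t' : VTree N ι, t'.Valid g ∧ t'.root = t.root ∧ t'.labels = t.labels ∧ t'.height ≤ H ∧
      ∃ p ∈ AddSubmonoid.closure {p | g.Pump t.labels p ∧ ∀ i, p i ≤ 2 ^ (H + 1)}, t.yield = t'.yield + p := by
  classical
  induction t with
  | leaf X v => exact ⟨.leaf X v, ht, rfl, rfl, by simp [height], 0, zero_mem _, by simp⟩
  | node X a b iha ihb =>
    obtain ⟨a', a1, a2, a3, a4, p, hp, ep⟩ := iha ht.2.1
    obtain ⟨b', b1, b2, b3, b4, q, hq, eq⟩ := ihb ht.2.2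
    have hv : (VTree.node X a' b').Valid g := ⟨by rw [a2, b2]; exact ht.1, a1, b1⟩
    have hl : (VTree.node X a' b').labels = (VTree.node X a b).labels := by
      simp only [labels, a3, b3]
    -- The compressed children have height at most `H`, so this node has yield at most `2 ^ (H +
    -- 1)`, which bounds the loops removed from it. All its labels are put into `W`, so none is
    -- lost.
    obtain ⟨t', h1, h2, h3, h4, h5, r, hr, er⟩ := exists_valid_height_le _ _ rfl hv
      (Finset.univ.filter (· ∈ (VTree.node X a' b').labels)) ∅ (by intro x; simp) (by simp)
    refine ⟨t', h1, h2, ?_, ?_, r + (p + q), add_mem ?_ (add_mem ?_ ?_), ?_⟩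
    · rw [← hl]
      refine h4.antisymm fun x hx => h3 (by simpa using hx)
    · refine h5.trans ?_
      rw [hH]
      have : (Finset.univ.filter (· ∈ (VTree.node X a' b').labels)).card ≤ Fintype.card N :=
        Finset.card_le_univ _
      have := Nat.mul_le_mul_right (Fintype.card N + 1) this
      simp only [Finset.card_empty]
      omega
    · refine AddSubmonoid.closure_mono ?_ hr
      rintro u ⟨h, h'⟩
      refine ⟨hl ▸ h, fun i => (h' i).trans ((hv.yield_le i).trans ?_)⟩
      refine Nat.pow_le_pow_right two_pos ?_
      simp only [height]; omega
    · refine AddSubmonoid.closure_mono ?_ hp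
      rintro u ⟨h, h'⟩
      exact ⟨h.mono (Set.subset_union_left.trans (Set.subset_insert _ _)), h'⟩
    · refine AddSubmonoid.closure_mono ?_ hq
      rintro u ⟨h, h'⟩
      exact ⟨h.mono (Set.subset_union_right.trans (Set.subset_insert _ _)), h'⟩
    · have : a'.yield + b'.yield = t'.yield + r := er
      simp only [yield, ep, eq]
      calc a'.yield + p + (b'.yield + q) = a'.yield + b'.yield + (p + q) := by abel
        _ = _ := by rw [this, add_assoc]

/-! ### Phases of sorted words -/

/-- `lo` and `hi` are the states in which a finite automaton that reads the letters in increasing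
order enters and leaves the word derived from a nonterminal; `pos` is the state reached by a
letter. -/
structure Phases (g : VecGrammar N ι) (pos : ι → ℕ) (lo hi : N → ℕ) : Prop where
  leaf : ∀ {X v}, g.leaf X v → lo X ≤ hi X ∧ ∀ i, v i ≠ 0 → lo X ≤ pos i ∧ pos i ≤ hi X
  bin : ∀ {X Y Z}, g.bin X Y Z → lo Y = lo X ∧ lo Z = hi Y ∧ hi Z = hi X

namespace Phases

variable {g : VecGrammar N ι} {pos : ι → ℕ} {lo hi : N → ℕ}

theorem labels_bounds (hg : g.Phases pos lo hi) {t : VTree N ι} (ht : t.Valid g) :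
    ∀ X ∈ t.labels, lo t.root ≤ lo X ∧ lo X ≤ hi X ∧ hi X ≤ hi t.root := by
  induction t with
  | leaf Y v =>
    rintro X rfl
    exact ⟨le_rfl, (hg.leaf ht).1, le_rfl⟩
  | node Y a b iha ihb =>
    have h := hg.bin ht.1
    have ha := iha ht.2.1
    have hb := ihb ht.2.2
    have ha' := ha _ a.root_mem_labels
    have hb' := hb _ b.root_mem_labels
    simp only [root]
    rintro X (rfl | hX | hX)
    · omega
    · have := ha X hX; omega
    · have := hb X hX; omega

theorem yield_bounds (hg : g.Phases pos lo hi) {t : VTree N ι} (ht : t.Valid g) {i : ι}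
    (hi' : t.yield i ≠ 0) : lo t.root ≤ pos i ∧ pos i ≤ hi t.root := by
  induction t with
  | leaf Y v => exact (hg.leaf ht).2 i hi'
  | node Y a b iha ihb =>
    have h := hg.bin ht.1
    have ha := hg.labels_bounds ht.2.1 _ a.root_mem_labels
    have hb := hg.labels_bounds ht.2.2 _ b.root_mem_labels
    simp only [root]
    by_cases h0 : a.yield i = 0
    · have := ihb ht.2.2 (by simpa [yield, h0] using hi'); omega
    · have := iha ht.2.1 h0; omega

/-- The two children split the interval of their parent at a common point, so the intervals in one
tree are nested or do not overlap. -/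
theorem not_cross (hg : g.Phases pos lo hi) {t : VTree N ι} (ht : t.Valid g) :
    ∀ X ∈ t.labels, ∀ Y ∈ t.labels, ¬ (lo X < lo Y ∧ lo Y < hi X ∧ hi X < hi Y) := by
  induction t with
  | leaf Y v =>
    rintro X rfl Z rfl
    omega
  | node W a b iha ihb =>
    have h := hg.bin ht.1
    have ha := hg.labels_bounds ht.2.1
    have hb := hg.labels_bounds ht.2.2
    have hr := ha _ a.root_mem_labels
    have hr' := hb _ b.root_mem_labels
    rintro X (rfl | hX | hX) Y (rfl | hY | hY)
    · omega
    · have := ha Y hY; omega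
    · have := hb Y hY; omega
    · have := ha X hX; omega
    · exact iha ht.2.1 X hX Y hY
    · have := ha X hX; have := hb Y hY; omega
    · have := hb X hX; omega
    · have := hb X hX; have := ha Y hY; omega
    · exact ihb ht.2.2 X hX Y hY

/-- What is derived to the left of `Y` is read between `lo X` and `lo Y`, what is derived to the
right between `hi Y` and `hi X`. For a loop both ranges shrink to single states. -/
theorem ctx_bounds (hg : g.Phases pos lo hi) {X Y : N} {p : ι → ℕ} (h : g.Ctx X Y p)
    (hY : lo Y ≤ hi Y) : lo X ≤ lo Y ∧ hi Y ≤ hi X ∧ ∀ i, p i ≠ 0 →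
      (lo X ≤ pos i ∧ pos i ≤ lo Y) ∨ (hi Y ≤ pos i ∧ pos i ≤ hi X) := by
  induction h with
  | refl X => simp
  | @left X Y Z p t hb ht hc ih =>
    obtain ⟨h1, h2, h3⟩ := ih hY
    have h := hg.bin hb
    have hr := hg.labels_bounds ht _ t.root_mem_labels
    refine ⟨by omega, by omega, fun i hpi => ?_⟩
    by_cases h0 : p i = 0
    · have := hg.yield_bounds ht (i := i) (by simpa [h0] using hpi); omega
    · have := h3 i h0; omega
  | @right X Y Z p t hb ht hc ih =>
    obtain ⟨h1, h2, h3⟩ := ih hY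
    have h := hg.bin hb
    have hr := hg.labels_bounds ht _ t.root_mem_labels
    refine ⟨by omega, by omega, fun i hpi => ?_⟩
    by_cases h0 : p i = 0
    · have := hg.yield_bounds ht (i := i) (by simpa [h0] using hpi); omega
    · have := h3 i h0; omega

end Phases

end VecGrammar

/-! ### Linear sets and Parikh's theorem with stratified periods -/

/-- The linear set with base `b` and periods `P`. -/
def linSet {ι : Type} (b : ι → ℕ) (P : Finset (ι → ℕ)) : Set (ι → ℕ) :=
  {z | ∃ c : (ι → ℕ) → ℕ, z = b + ∑ p ∈ P, c p • p}

/-- A set of periods is stratified if each of them has at most two nonzero coordinates and no two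
of them cross. -/
def Stratified {ι : Type} [LinearOrder ι] (P : Finset (ι → ℕ)) : Prop :=
  (∀ p ∈ P, ∀ i j l, p i ≠ 0 → p j ≠ 0 → p l ≠ 0 → i = j ∨ j = l ∨ i = l) ∧
    ∀ p ∈ P, ∀ q ∈ P, ∀ i j l r, i < j → j < l → l < r →
      p i ≠ 0 → p l ≠ 0 → q j ≠ 0 → q r ≠ 0 → False

namespace VecGrammar

open VTree

/-- A loop at `X` contains only letters at the states `lo X` and `hi X`, hence at most two different
letters. Crossing periods would give crossing intervals of labels in one tree. -/
theorem Phases.stratified {N ι : Type} [LinearOrder ι] {g : VecGrammar N ι} {pos : ι → ℕ}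
    {lo hi : N → ℕ} (hg : g.Phases pos lo hi) (hpos : StrictMono pos) {t : VTree N ι}
    (ht : t.Valid g) {P : Finset (ι → ℕ)} (hP : ∀ p ∈ P, g.Pump t.labels p) : Stratified P := by
  have supp : ∀ p ∈ P, ∃ X ∈ t.labels, lo X ≤ hi X ∧
      ∀ i, p i ≠ 0 → pos i = lo X ∨ pos i = hi X := by
    intro p hp
    obtain ⟨X, hX, hc⟩ := hP p hp
    have hb := (hg.labels_bounds ht X hX).2.1
    refine ⟨X, hX, hb, fun i hi' => ?_⟩
    have := (hg.ctx_bounds hc hb).2.2 i hi'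
    omega
  constructor
  · intro p hp i j l h1 h2 h3
    obtain ⟨X, -, -, hs⟩ := supp p hp
    have := hs i h1
    have := hs j h2
    have := hs l h3
    have inj : ∀ x y, pos x = pos y → x = y := fun x y h => hpos.injective h
    by_contra! h
    have := mt (inj i j) h.1
    have := mt (inj j l) h.2.1
    have := mt (inj i l) h.2.2
    omega
  · intro p hp q hq i j l r hij hjl hlr h1 h2 h3 h4
    obtain ⟨X, hX, hX', hs⟩ := supp p hp
    obtain ⟨Y, hY, hY', hs'⟩ := supp q hq
    have := hs i h1
    have := hs l h2
    have := hs' j h3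
    have := hs' r h4
    have := hpos hij
    have := hpos hjl
    have := hpos hlr
    have := hg.not_cross ht X hX Y hY
    omega

theorem exists_valid_add_sum {N ι : Type} {g : VecGrammar N ι} {t : VTree N ι} (ht : t.Valid g)
    {P : Finset (ι → ℕ)} (hP : ∀ p ∈ P, g.Pump t.labels p) (c : (ι → ℕ) → ℕ) :
    ∃ t' : VTree N ι, t'.Valid g ∧ t'.root = t.root ∧ t'.yield = t.yield + ∑ p ∈ P, c p • p ∧
      t.labels ⊆ t'.labels := by
  classical
  induction P using Finset.induction_on with
  | empty => exact ⟨t, ht, rfl, by simp, subset_rfl⟩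
  | insert q P hq ih =>
    obtain ⟨t₁, h1, h2, h3, h4⟩ := ih fun p hp => hP p (Finset.mem_insert_of_mem hp)
    obtain ⟨X, hX, hc⟩ := hP q (Finset.mem_insert_self _ _)
    have iter : ∀ n : ℕ, ∃ t' : VTree N ι, t'.Valid g ∧ t'.root = t₁.root ∧
        t'.yield = t₁.yield + n • q ∧ t₁.labels ⊆ t'.labels := by
      intro n
      induction n with
      | zero => exact ⟨t₁, h1, rfl, by simp, subset_rfl⟩
      | succ n ih =>
        obtain ⟨t₂, k1, k2, k3, k4⟩ := ih
        obtain ⟨t₃, l1, l2, l3, l4⟩ := exists_valid_add_pump hc k1 (k4 (h4 hX))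
        exact ⟨t₃, l1, l2.trans k2, by rw [l3, k3, succ_nsmul, add_assoc], k4.trans l4⟩
    obtain ⟨t₂, k1, k2, k3, k4⟩ := iter (c q)
    refine ⟨t₂, k1, k2.trans h2, ?_, h4.trans k4⟩
    rw [k3, h3, Finset.sum_insert hq]; abel

/-- Parikh's theorem, with stratified periods. -/
theorem Phases.exists_linSets {N ι : Type} [Finite N] [Finite ι] [LinearOrder ι]
    {g : VecGrammar N ι} {pos : ι → ℕ} {lo hi : N → ℕ} (hg : g.Phases pos lo hi)
    (hpos : StrictMono pos) (S : N) :
    ∃ 𝓛 : Set ((ι → ℕ) × Finset (ι → ℕ)), 𝓛.Finite ∧ (∀ L ∈ 𝓛, Stratified L.2) ∧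
      ∀ v, (∃ t : VTree N ι, t.Valid g ∧ t.root = S ∧ t.yield = v) ↔
        ∃ L ∈ 𝓛, v ∈ linSet L.1 L.2 := by
  classical
  have := Fintype.ofFinite N
  have := Fintype.ofFinite ι
  obtain ⟨H, hH⟩ : ∃ H, H = Fintype.card N * (Fintype.card N + 1) + Fintype.card N := ⟨_, rfl⟩
  have bdd : ∀ B : ℕ, {v : ι → ℕ | ∀ i, v i ≤ B}.Finite := fun B => by
    refine (Set.Finite.pi' fun _ : ι => Set.finite_Iic B).subset ?_
    intro v hv i
    exact hv i
  have fin : ∀ U : Set N, {p | g.Pump U p ∧ ∀ i, p i ≤ 2 ^ (H + 1)}.Finite := fun U =>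
    (bdd _).subset fun p hp => hp.2
  -- One linear set for each tree of height at most `H`: its base is the yield, its periods are the
  -- bounded loops at its labels.
  refine ⟨{L | ∃ t : VTree N ι, t.Valid g ∧ t.root = S ∧ t.height ≤ H ∧ L.1 = t.yield ∧
    L.2 = (fin t.labels).toFinset}, ?_, ?_, fun v => ⟨?_, ?_⟩⟩
  · refine ((bdd (2 ^ H)).prod (Set.finite_range fun U : Set N => (fin U).toFinset)).subset ?_
    rintro ⟨b, P⟩ ⟨t, h1, -, h2, h3, h4⟩
    refine ⟨?_, t.labels, h4.symm⟩
    intro i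
    simp only at h3
    rw [h3]
    exact (h1.yield_le i).trans (Nat.pow_le_pow_right two_pos h2)
  · rintro ⟨b, P⟩ ⟨t, h1, -, -, -, rfl⟩
    refine hg.stratified hpos h1 fun p hp => ?_
    exact ((Set.Finite.mem_toFinset _).1 hp).1
  · rintro ⟨t, ht, hr, rfl⟩
    obtain ⟨t', h1, h2, h3, h4, p, hp, e⟩ := exists_valid_labels_eq hH ht
    refine ⟨(t'.yield, (fin t.labels).toFinset),
      ⟨t', h1, h2.trans hr, h4, rfl, by rw [h3]⟩, ?_⟩
    have : AddSubmonoid.closure {p | g.Pump t.labels p ∧ ∀ i, p i ≤ 2 ^ (H + 1)} =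
        AddSubmonoid.closure ((fin t.labels).toFinset : Set (ι → ℕ)) := by simp
    rw [this, AddSubmonoid.mem_closure_finset] at hp
    obtain ⟨c, -, hc⟩ := hp
    exact ⟨c, by simp only [hc, e]⟩
  · rintro ⟨⟨b, P⟩, ⟨t, h1, h2, -, rfl, rfl⟩, c, rfl⟩
    obtain ⟨t', k1, k2, k3, -⟩ := exists_valid_add_sum h1
      (P := (fin t.labels).toFinset) (fun p hp => ((Set.Finite.mem_toFinset _).1 hp).1) c
    exact ⟨t', k1, k2.trans h2, k3⟩

end VecGrammar

/-! ### Components and orthogonal spaces of stratified period sets -/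

section Stratified

variable {ι : Type}

/-- Two coordinates are joined if some period is nonzero at both. -/
def PeriodAdj (P : Finset (ι → ℕ)) (x y : ι) : Prop := ∃ p ∈ P, p x ≠ 0 ∧ p y ≠ 0

/-- Connectedness of coordinates by periods. -/
def Linked (P : Finset (ι → ℕ)) : ι → ι → Prop := Relation.ReflTransGen (PeriodAdj P)

theorem PeriodAdj.symm {P : Finset (ι → ℕ)} {x y : ι} (h : PeriodAdj P x y) : PeriodAdj P y x := by
  obtain ⟨p, hp, h1, h2⟩ := h
  exact ⟨p, hp, h2, h1⟩

theorem Linked.symm {P : Finset (ι → ℕ)} {x y : ι} (h : Linked P x y) : Linked P y x := by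
  induction h with
  | refl => exact .refl
  | tail _ h ih => exact .head h.symm ih

theorem Stratified.not_cross [LinearOrder ι] {P : Finset (ι → ℕ)} (hP : Stratified P) {i j l r : ι} (h1 : i < j)
    (h2 : j < l) (h3 : l < r) (h : PeriodAdj P i l) (h' : PeriodAdj P j r) : False := by
  obtain ⟨p, hp, a, b⟩ := h
  obtain ⟨q, hq, c, d⟩ := h'
  exact hP.2 p hp q hq i j l r h1 h2 h3 a b c d

/-- Crossing pairs of linked coordinates belong to one component. -/
theorem Stratified.linked_of_cross [LinearOrder ι] {P : Finset (ι → ℕ)} (hP : Stratified P) {p q r s : ι}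
    (hpq : p < q) (hqr : q < r) (hrs : r < s) (hpr : Linked P p r) (hqs : Linked P q s) :
    Linked P p q := by
  by_contra hne
  have ne : ∀ x y, Linked P p x → Linked P q y → x ≠ y := by
    rintro x _ hx hy rfl
    exact hne (hx.trans hy.symm)
  -- Assume the components of `p` and `q` are disjoint. An edge of one that starts strictly inside
  -- an edge of the other must end there; `fwd` and `bwd` extend this along paths.
  have inner : ∀ l l' x y, Linked P p l → PeriodAdj P l l' → Linked P q x → PeriodAdj P x y →
      l < x → x < l' → l < y ∧ y < l' := by
    intro l l' x y hl hll hx hxy h1 h2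
    have hy : Linked P q y := Relation.ReflTransGen.tail hx hxy
    have hl' : Linked P p l' := Relation.ReflTransGen.tail hl hll
    have n1 := ne l y hl hy
    have n2 := ne l' y hl' hy
    constructor
    · by_contra! h
      exact hP.not_cross (lt_of_le_of_ne h n1.symm) h1 h2 hxy.symm hll
    · by_contra! h
      exact hP.not_cross h1 h2 (lt_of_le_of_ne h n2) hll hxy
  have fwd : ∀ l l' y, Linked P p l → PeriodAdj P l l' → Linked P q y → l < q → q < l' →
      l < y ∧ y < l' := by
    intro l l' y hl hll hy h1 h2
    induction hy with
    | refl => exact ⟨h1, h2⟩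
    | tail hx hxy ih => exact inner l l' _ _ hl hll hx hxy ih.1 ih.2
  have bwd : ∀ l l' y, Linked P p l → PeriodAdj P l l' → Linked P q y → l < y → y < l' →
      l < q ∧ q < l' := by
    intro l l' y hl hll hy h1 h2
    induction hy with
    | refl => exact ⟨h1, h2⟩
    | @tail x y hx hxy ih =>
      have := inner l l' y x hl hll (Relation.ReflTransGen.tail hx hxy) hxy.symm h1 h2
      exact ih this.1 this.2
  -- An edge from the component of `p` that left the interval from `q` to `s` would span exactly one
  -- of `q` and `s`, although these are linked. So the whole component of `r` stays inside,
  -- contradicting `p < q`.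
  have step : ∀ l l', Linked P p l → PeriodAdj P l l' → q < l → l < s → q < l' ∧ l' < s := by
    intro l l' hl hll h1 h2
    have hl' : Linked P p l' := Relation.ReflTransGen.tail hl hll
    constructor
    · by_contra! h
      have := fwd l' l s hl' hll.symm hqs
        (lt_of_le_of_ne h (ne l' q hl' .refl)) h1
      exact absurd h2 this.2.le.not_gt
    · by_contra! h
      have := bwd l l' s hl hll hqs h2 (lt_of_le_of_ne h (ne l' s hl' hqs).symm)
      exact absurd h1 this.1.le.not_gt
  have : ∀ y, Linked P r y → q < y ∧ y < s := by
    intro y hy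
    induction hy with
    | refl => exact ⟨hqr, hrs⟩
    | tail hx hxy ih => exact step _ _ (hpr.trans hx) hxy ih.1 ih.2
  exact absurd hpq (this p hpr.symm).1.le.not_gt

variable [Fintype ι]

/-- The vectors orthogonal to all periods. -/
def orth (P : Finset (ι → ℕ)) : Submodule ℚ (ι → ℚ) where
  carrier := {φ | ∀ p ∈ P, ∑ i, φ i * p i = 0}
  add_mem' {φ ψ} hφ hψ p hp := by
    simp [add_mul, Finset.sum_add_distrib, hφ p hp, hψ p hp]
  zero_mem' p _ := by simp
  smul_mem' c φ hφ p hp := by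
    simp [mul_assoc, ← Finset.mul_sum, hφ p hp]

-- The support of a period lies in one component, so restricting `φ` to a component leaves its
-- pairing with the period unchanged or makes it zero.
open scoped Classical in
theorem restrict_mem_orth {P : Finset (ι → ℕ)} {φ : ι → ℚ} (hφ : φ ∈ orth P) (x : ι) :
    (fun i => if Linked P x i then φ i else 0) ∈ orth P := by
  intro p hp
  by_cases h : ∃ s, Linked P x s ∧ p s ≠ 0
  · obtain ⟨s, hs, hps⟩ := h
    refine Eq.trans ?_ (hφ p hp)
    refine Finset.sum_congr rfl fun i _ => ?_
    by_cases h0 : p i = 0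
    · simp [h0]
    · simp only [if_pos (show Linked P x i from .tail hs ⟨p, hp, hps, h0⟩)]
  · push Not at h
    refine Finset.sum_eq_zero fun i _ => ?_
    by_cases hi : Linked P x i
    · simp [h i hi]
    · simp [hi]

/-- A period joining two different coordinates has no third one, so orthogonality is a two-term
relation in which both values of `φ` vanish or neither does. -/
theorem Stratified.ne_zero_of_linked [LinearOrder ι] {P : Finset (ι → ℕ)} (hP : Stratified P) {φ : ι → ℚ}
    (hφ : φ ∈ orth P) {x y : ι} (h : Linked P x y) (hx : φ x ≠ 0) : φ y ≠ 0 := by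
  induction h with
  | refl => exact hx
  | @tail x y _ h hx =>
    obtain ⟨p, hp, h1, h2⟩ := h
    by_cases hxy : x = y
    · rwa [← hxy]
    have hsum := hφ p hp
    rw [Finset.sum_eq_add x y hxy ?_ (by simp) (by simp)] at hsum
    · intro hy
      simp [hy, hx, h1] at hsum
    · rintro l - ⟨hlx, hly⟩
      by_contra hl
      have hl : p l ≠ 0 := by rintro h; simp [h] at hl
      rcases hP.1 p hp x y l h1 h2 hl with h | h | h
      · exact hxy h
      · exact hly h.symm
      · exact hlx h.symm

/-- If the orthogonal space of a stratified set kills the diagonal, then it has dimension at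
most one. -/
theorem Stratified.orth_le_span {m : ℕ} {P : Finset (Fin (m + m) → ℕ)} (hP : Stratified P)
    (h : ∀ φ ∈ orth P, ∀ i : Fin m, φ (Fin.castAdd m i) + φ (Fin.natAdd m i) = 0) :
    ∃ φ₀ : Fin (m + m) → ℚ, ∀ φ ∈ orth P, ∃ c : ℚ, φ = c • φ₀ := by
  by_cases h0 : ∀ φ ∈ orth P, φ = 0
  · exact ⟨0, fun φ hφ => ⟨0, by simp [h0 φ hφ]⟩⟩
  have ext : ∀ φ ∈ orth P, (∀ i : Fin m, φ (Fin.castAdd m i) = 0) → φ = 0 := by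
    intro φ hφ h'
    funext x
    refine Fin.addCases (fun i => h' i) (fun i => ?_) x
    have := h φ hφ i
    rwa [h' i, zero_add] at this
  push Not at h0
  obtain ⟨φ₀, hφ₀, hne⟩ := h0
  obtain ⟨i, hi⟩ : ∃ i : Fin m, φ₀ (Fin.castAdd m i) ≠ 0 := by
    by_contra! h'
    exact hne (ext φ₀ hφ₀ h')
  refine ⟨φ₀, fun φ hφ => ⟨φ (Fin.castAdd m i) / φ₀ (Fin.castAdd m i), ?_⟩⟩
  set c := φ (Fin.castAdd m i) / φ₀ (Fin.castAdd m i) with hc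
  rw [← sub_eq_zero]
  have hχ : φ - c • φ₀ ∈ orth P := sub_mem hφ (Submodule.smul_mem _ _ hφ₀)
  have hχi : (φ - c • φ₀) (Fin.castAdd m i) = 0 := by simp [hc, hi]
  refine ext _ hχ fun j => ?_
  by_contra hj
  -- Otherwise the restriction of `φ` to the component of the first coordinate would be orthogonal
  -- to all periods without killing the diagonal.
  have pair : ∀ φ ∈ orth P, ∀ i : Fin m, φ (Fin.castAdd m i) ≠ 0 →
      Linked P (Fin.castAdd m i) (Fin.natAdd m i) := by
    classical
    intro φ hφ i hi
    by_contra hl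
    have := h _ (restrict_mem_orth hφ (Fin.castAdd m i)) i
    simp only [hl, if_false, add_zero] at this
    rw [if_pos .refl] at this
    exact hi this
  have li := pair _ hφ₀ i hi
  have lj := pair _ hχ j hj
  -- For `i < j` the order is `i`, `j`, partner of `i`, partner of `j`: the two linked pairs cross.
  have link : Linked P (Fin.castAdd m j) (Fin.castAdd m i) := by
    have hlt : ∀ x y : Fin m, Fin.castAdd m x < Fin.natAdd m y := by
      intro x y; rw [Fin.lt_def]; simp; omega
    rcases lt_trichotomy i j with hij | rfl | hij
    · exact (hP.linked_of_cross (r := Fin.natAdd m i) (by rw [Fin.lt_def] at hij ⊢; simpa using hij) (hlt _ _)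
        (by rw [Fin.lt_def] at hij ⊢; simpa using hij) li lj).symm
    · exact .refl
    · exact hP.linked_of_cross (r := Fin.natAdd m j) (by rw [Fin.lt_def] at hij ⊢; simpa using hij) (hlt _ _)
        (by rw [Fin.lt_def] at hij ⊢; simpa using hij) lj li
  exact hP.ne_zero_of_linked hχ link hj hχi

/-- A rational vector orthogonal to `orth P` is, up to a positive factor, a difference of
combinations of the periods. -/
theorem exists_nsmul_eq_sub {P : Finset (ι → ℕ)} {w : ι → ℚ}
    (hw : ∀ φ ∈ orth P, ∑ i, φ i * w i = 0) :
    ∃ n : ℕ, 0 < n ∧ ∃ c d : (ι → ℕ) → ℕ, ∀ i,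
      (n : ℚ) * w i + ((∑ p ∈ P, c p • p) i : ℕ) = ((∑ p ∈ P, d p • p) i : ℕ) := by
  classical
  have hmem : w ∈ Submodule.span ℚ ((fun p : ι → ℕ => fun i => (p i : ℚ)) '' P) := by
    -- A functional that vanishes on the span but not at `w` would be a vector of `orth P` violating
    -- `hw`.
    by_contra hn
    obtain ⟨f, hf, hle⟩ := Submodule.exists_le_ker_of_notMem hn
    have hf' : ∀ v : ι → ℚ, f v = ∑ i, f (Pi.single i 1) * v i := by
      intro v
      conv_lhs => rw [← Finset.univ_sum_single v, map_sum]
      refine Finset.sum_congr rfl fun i _ => ?_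
      rw [mul_comm, ← smul_eq_mul, ← map_smul, ← Pi.single_smul]
      simp
    refine hf ?_
    rw [hf']
    refine hw (fun i => f (Pi.single i 1)) fun p hp => ?_
    rw [← hf' (fun i => (p i : ℚ))]
    exact hle (Submodule.subset_span ⟨p, hp, rfl⟩)
  have comb : ∀ (c d : (ι → ℕ) → ℕ) (a b : ℕ), ∑ p ∈ P, (a * c p + b * d p) • p =
      a • ∑ p ∈ P, c p • p + b • ∑ p ∈ P, d p • p := by
    intro c d a b
    simp only [Finset.smul_sum, ← Finset.sum_add_distrib]
    refine Finset.sum_congr rfl fun p _ => ?_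
    rw [add_smul, mul_smul, mul_smul]
  clear hw
  induction hmem using Submodule.span_induction with
  | mem x hx =>
    obtain ⟨p, hp, rfl⟩ := hx
    refine ⟨1, one_pos, 0, Pi.single p 1, fun i => ?_⟩
    have : ∑ q ∈ P, (Pi.single p 1 : (ι → ℕ) → ℕ) q • q = p := by
      rw [Finset.sum_eq_single_of_mem p hp (fun q _ hq => by rw [Pi.single_eq_of_ne hq, zero_smul])]
      simp
    rw [this]
    simp
  | zero => exact ⟨1, one_pos, 0, 0, by simp⟩
  | add x y _ _ hx hy =>
    obtain ⟨n, hn, c, d, h⟩ := hx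
    obtain ⟨n', hn', c', d', h'⟩ := hy
    refine ⟨n * n', Nat.mul_pos hn hn', fun p => n' * c p + n * c' p,
      fun p => n' * d p + n * d' p, fun i => ?_⟩
    rw [comb, comb]
    simp only [Pi.add_apply, Pi.smul_apply, smul_eq_mul]
    push_cast [← h i, ← h' i]
    ring
  | smul a x _ hx =>
    obtain ⟨n, hn, c, d, h⟩ := hx
    -- The positive and negative parts of the numerator; a negative sign exchanges the roles of `c`
    -- and `d`.
    obtain ⟨u, v, huv⟩ : ∃ u v : ℕ, a * a.den = (u : ℚ) - v := by
      refine ⟨a.num.toNat, (-a.num).toNat, ?_⟩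
      rw [Rat.mul_den_eq_num]
      have : a.num = (a.num.toNat : ℤ) - ((-a.num).toNat : ℤ) := by omega
      exact_mod_cast this
    refine ⟨n * a.den, Nat.mul_pos hn a.den_pos, fun p => u * c p + v * d p,
      fun p => u * d p + v * c p, fun i => ?_⟩
    rw [comb, comb]
    simp only [Pi.add_apply, Pi.smul_apply, smul_eq_mul]
    push_cast [← h i]
    linear_combination (n : ℚ) * x i * huv

end Stratified

/-! ### Intersections of linear sets and the moment curve -/

/-- A point of a linear set either stays in it after moving the base by a fixed combination of the
periods, or some period occurs in it boundedly often. -/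
theorem mem_linSet_add_or {ι : Type} [DecidableEq (ι → ℕ)] {b z : ι → ℕ} {P : Finset (ι → ℕ)}
    (c : (ι → ℕ) → ℕ) (hz : z ∈ linSet b P) :
    z ∈ linSet (b + ∑ p ∈ P, c p • p) P ∨
      ∃ p ∈ P, ∃ i < c p, z ∈ linSet (b + i • p) (P.erase p) := by
  obtain ⟨d, rfl⟩ := hz
  by_cases h : ∀ p ∈ P, c p ≤ d p
  · left
    refine ⟨fun p => d p - c p, ?_⟩
    rw [add_assoc, ← Finset.sum_add_distrib]
    congr 1
    refine Finset.sum_congr rfl fun p hp => ?_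
    rw [← add_smul, Nat.add_sub_cancel' (h p hp)]
  · right
    push Not at h
    obtain ⟨p, hp, hlt⟩ := h
    exact ⟨p, hp, d p, hlt, d, by rw [add_assoc, Finset.add_sum_erase P (fun q => d q • q) hp]⟩

theorem linSet_erase_subset {ι : Type} [DecidableEq (ι → ℕ)] {b : ι → ℕ} {P : Finset (ι → ℕ)} {p : ι → ℕ}
    (hp : p ∈ P) (i : ℕ) : linSet (b + i • p) (P.erase p) ⊆ linSet b P := by
  rintro z ⟨c, rfl⟩
  refine ⟨Function.update c p i, ?_⟩
  rw [← Finset.add_sum_erase P _ hp, add_assoc, Function.update_self]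
  congr 2
  refine Finset.sum_congr rfl fun q hq => ?_
  rw [Function.update_of_ne (Finset.ne_of_mem_erase hq)]

theorem Stratified.erase {ι : Type} [LinearOrder ι] [DecidableEq (ι → ℕ)] {P : Finset (ι → ℕ)}
    (hP : Stratified P) (p : ι → ℕ) : Stratified (P.erase p) :=
  ⟨fun q hq => hP.1 q (Finset.mem_of_mem_erase hq), fun q hq r hr =>
    hP.2 q (Finset.mem_of_mem_erase hq) r (Finset.mem_of_mem_erase hr)⟩

/-- The doubled moment curve. -/
def momentPoint (m t : ℕ) : Fin (m + m) → ℕ :=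
  Fin.append (fun i : Fin m => t ^ (i.val + 1)) (fun i : Fin m => t ^ (i.val + 1))

/-- The condition says that `t` is a root of a nonzero polynomial: all exponents are positive, so
the constant `c` cannot cancel any `a i`. -/
theorem finite_setOf_sum_pow_eq {m : ℕ} {a : Fin m → ℚ} (ha : ∃ i, a i ≠ 0) (c : ℚ) :
    {t : ℕ | ∑ i, a i * (t : ℚ) ^ (i.val + 1) = c}.Finite := by
  set p : Polynomial ℚ := ∑ i, Polynomial.C (a i) * Polynomial.X ^ (i.val + 1) - Polynomial.C c
    with hp
  obtain ⟨i, hi⟩ := ha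
  have hne : p ≠ 0 := by
    intro h
    have hcoeff : p.coeff (i.val + 1) = a i := by
      rw [hp, Polynomial.coeff_sub, Polynomial.finsetSum_coeff, Finset.sum_eq_single i]
      · simp
      · intro j _ hj
        rw [Polynomial.coeff_C_mul_X_pow, if_neg]
        intro h; exact hj (Fin.ext (by omega))
      · simp
    rw [h, Polynomial.coeff_zero] at hcoeff
    exact hi hcoeff.symm
  have hfin : {x : ℚ | p.IsRoot x}.Finite := Polynomial.finite_setOfPred_isRoot hne
  refine (hfin.preimage (f := fun t : ℕ => (t : ℚ)) (Nat.cast_injective.injOn)).subset ?_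
  intro t ht
  simp only [Set.mem_ofPred_eq] at ht
  simp [hp, Polynomial.IsRoot, Polynomial.eval_finsetSum, ht]

/-- If a point set meets `k` stratified linear sets only in the diagonal of dimension greater than
`k`, then it contains only finitely many points of the moment curve. -/
theorem finite_setOf_momentPoint_mem {k : ℕ} (hk : 0 < k) (n : ℕ) :
    ∀ (b : Fin k → Fin ((k + 1) + (k + 1)) → ℕ)
      (P : Fin k → Finset (Fin ((k + 1) + (k + 1)) → ℕ)),
      ∑ j, (P j).card = n → (∀ j, Stratified (P j)) →
      (∀ z, (∀ j, z ∈ linSet (b j) (P j)) →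
        ∀ i : Fin (k + 1), z (Fin.castAdd (k + 1) i) = z (Fin.natAdd (k + 1) i)) →
      {t : ℕ | ∀ j, momentPoint (k + 1) t ∈ linSet (b j) (P j)}.Finite := by
  classical
  induction n using Nat.strong_induction_on with
  | _ n ih =>
  intro b P hn hP hdiag
  -- In the first case `φ` is constant on the linear set and gives a nontrivial polynomial equation
  -- for `t`.
  by_cases hcase : ∃ j, ∃ φ ∈ orth (P j), ∃ i : Fin (k + 1),
      φ (Fin.castAdd (k + 1) i) + φ (Fin.natAdd (k + 1) i) ≠ 0
  · obtain ⟨j, φ, hφ, hne⟩ := hcase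
    refine (finite_setOf_sum_pow_eq hne (∑ i, φ i * b j i)).subset ?_
    intro t ht
    obtain ⟨c, hc⟩ := ht j
    have h1 : ∑ i, φ i * (momentPoint (k + 1) t i : ℚ) = ∑ i, φ i * b j i := by
      rw [hc]
      simp only [Pi.add_apply, Nat.cast_add, mul_add, Finset.sum_add_distrib, Finset.sum_apply,
        Pi.smul_apply, smul_eq_mul, Nat.cast_sum, Nat.cast_mul, Finset.mul_sum]
      rw [Finset.sum_comm, Finset.sum_eq_zero (s := P j), add_zero]
      intro p hp
      have := hφ p hp
      calc ∑ i, φ i * ((c p : ℚ) * p i) = c p * ∑ i, φ i * p i := by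
            rw [Finset.mul_sum]; exact Finset.sum_congr rfl fun i _ => by ring
        _ = 0 := by rw [this, mul_zero]
    rw [Set.mem_ofPred_eq, ← h1, Fin.sum_univ_add fun i => φ i * (momentPoint (k + 1) t i : ℚ)]
    simp only [momentPoint, Fin.append_left, Fin.append_right, add_mul, Finset.sum_add_distrib,
      Nat.cast_pow]
  push Not at hcase
  choose φ hφ using fun j => (hP j).orth_le_span (hcase j)
  -- There are `k` linear conditions on `k + 1` unknowns.
  obtain ⟨w, hw0, hw⟩ : ∃ w : Fin (k + 1) → ℚ, w ≠ 0 ∧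
      ∀ j, ∑ i, φ j (Fin.castAdd (k + 1) i) * w i = 0 := by
    let L : (Fin (k + 1) → ℚ) →ₗ[ℚ] (Fin k → ℚ) :=
      Matrix.mulVecLin (Matrix.of fun j i => φ j (Fin.castAdd (k + 1) i))
    have : LinearMap.ker L ≠ ⊥ := LinearMap.ker_ne_bot_of_finrank_lt (by simp)
    obtain ⟨w, hw, hw0⟩ := (Submodule.ne_bot_iff _).1 this
    refine ⟨w, hw0, fun j => ?_⟩
    have := congrFun (LinearMap.mem_ker.1 hw) j
    simpa [L, Matrix.mulVec, dotProduct] using this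
  have horth : ∀ j, ∀ ψ ∈ orth (P j), ∑ i, ψ i * (Fin.append w 0 : Fin _ → ℚ) i = 0 := by
    intro j ψ hψ
    obtain ⟨c, rfl⟩ := hφ j ψ hψ
    rw [Fin.sum_univ_add]
    simp only [Pi.smul_apply, smul_eq_mul, Fin.append_left, Fin.append_right, Pi.zero_apply,
      mul_zero, Finset.sum_const_zero, add_zero, mul_assoc, ← Finset.mul_sum, hw j]
  choose N hN c d hcd using fun j => exists_nsmul_eq_sub (horth j)
  -- These factors bring the denominators `N j` to the common multiple `∏ l, N l`, so that one and
  -- the same displacement works in all the linear sets.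
  let r : Fin k → ℕ := fun j => ∏ l ∈ Finset.univ.erase j, N l
  have hr : ∀ j, r j * N j = ∏ l, N l := fun j => Finset.prod_erase_mul _ _ (Finset.mem_univ j)
  have hcover : {t : ℕ | ∀ j, momentPoint (k + 1) t ∈ linSet (b j) (P j)} ⊆
      ⋃ j : Fin k, ⋃ p ∈ P j, ⋃ i ∈ Finset.range (r j * c j p),
        {t : ℕ | ∀ l, momentPoint (k + 1) t ∈ linSet (Function.update b j (b j + i • p) l)
          (Function.update P j ((P j).erase p) l)} := by
    intro t ht
    -- If every period in every set is used often enough, the point can be moved by `∏ l, N l` times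
    -- `(w, 0)` within all the sets, and it leaves the diagonal.
    by_cases hall : ∀ j, momentPoint (k + 1) t ∈
        linSet (b j + ∑ p ∈ P j, (r j * c j p) • p) (P j)
    · exfalso
      choose e he using hall
      have hz : ∀ j i, ((b j + ∑ p ∈ P j, (r j * d j p + e j p) • p : Fin _ → ℕ) i : ℚ) =
          momentPoint (k + 1) t i + ((∏ l, N l : ℕ) : ℚ) * (Fin.append w 0 : Fin _ → ℚ) i := by
        intro j i
        have h1 := hcd j i
        have h2 := congrFun (he j) i
        have hs : ∀ f : (Fin (k + 1 + (k + 1)) → ℕ) → ℕ, ∑ p ∈ P j, (r j * f p) • p =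
            r j • ∑ p ∈ P j, f p • p := by
          intro f; rw [Finset.smul_sum]
          exact Finset.sum_congr rfl fun p _ => mul_smul _ _ _
        simp only [add_smul, Finset.sum_add_distrib, hs] at h2 ⊢
        rw [h2, ← hr j]
        simp only [Pi.add_apply, Pi.smul_apply, smul_eq_mul]
        push_cast [← h1]
        ring
      let j₀ : Fin k := ⟨0, hk⟩
      have hmem : ∀ j, (b j₀ + ∑ p ∈ P j₀, (r j₀ * d j₀ p + e j₀ p) • p) ∈
          linSet (b j) (P j) := by
        intro j
        refine ⟨fun p => r j * d j p + e j p, ?_⟩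
        funext i
        have := (hz j₀ i).trans (hz j i).symm
        exact_mod_cast this
      refine hw0 (funext fun i => ?_)
      have h1 := hdiag _ hmem i
      have h2 := hz j₀ (Fin.castAdd (k + 1) i)
      have h3 := hz j₀ (Fin.natAdd (k + 1) i)
      rw [h1, h3] at h2
      have hpos : (0 : ℚ) < ((∏ l, N l : ℕ) : ℚ) := by
        exact_mod_cast Finset.prod_pos fun l _ => hN l
      simp only [momentPoint, Fin.append_left, Fin.append_right, Pi.zero_apply, mul_zero,
        add_zero, left_eq_add, mul_eq_zero] at h2
      exact h2.resolve_left hpos.ne'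
    · push Not at hall
      obtain ⟨j, hj⟩ := hall
      obtain ⟨p, hp, i, hi, hm⟩ := (mem_linSet_add_or (fun p => r j * c j p) (ht j)).resolve_left hj
      simp only [Set.mem_iUnion]
      refine ⟨j, p, hp, i, Finset.mem_range.2 hi, fun l => ?_⟩
      by_cases hl : l = j
      · subst hl; simpa using hm
      · simpa [hl] using ht l
  refine Set.Finite.subset ?_ hcover
  refine Set.finite_iUnion fun j => Set.Finite.biUnion (Finset.finite_toSet _) fun p hp =>
    Set.Finite.biUnion (Finset.finite_toSet _) fun i _ => ?_
  -- Fixing the multiplicity `i` of `p` removes one period and shrinks one linear set, so the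
  -- diagonal condition survives.
  refine ih _ ?_ _ _ rfl ?_ ?_
  · rw [← hn]
    refine Finset.sum_lt_sum (fun l _ => ?_) ⟨j, Finset.mem_univ _, ?_⟩
    · by_cases hl : l = j
      · subst hl; simpa using Finset.card_le_card (Finset.erase_subset p (P l))
      · simp [hl]
    · simpa using Finset.card_erase_lt_of_mem hp
  · intro l
    by_cases hl : l = j
    · subst hl; simpa using (hP l).erase p
    · simpa [hl] using hP l
  · intro z hz
    refine hdiag z fun l => ?_
    have := hz l
    by_cases hl : l = j
    · subst hl
      simp only [Function.update_self] at this
      exact linSet_erase_subset hp i this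
    · simpa [hl] using this

/-! ### The triple construction: from npda's to grammars -/

instance {A : Type} [Finite A] : Finite (TapeSym A) :=
  Finite.of_injective (β := Option (Option A)) (fun s => match s with
    | .left => none
    | .right => some none
    | .letter a => some (some a)) (by
      intro s t h
      cases s <;> cases t <;> simp_all)

namespace NPDA

variable {A B : Type}

theorem StepsIn.head {M : NPDA A B} {t : ℕ} {c d e : M.Config} (hs : M.Step c d)
    (h : M.StepsIn t d e) : M.StepsIn (t + 1) c e := by
  induction h with
  | refl d => exact .tail (.refl c) hs
  | tail _ h' ih => exact .tail (ih hs) h'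

theorem exists_stepsIn_iff {M : NPDA A B} {c d : M.Config} :
    (∃ t, M.StepsIn t c d) ↔ Relation.ReflTransGen M.Step c d := by
  constructor
  · rintro ⟨t, h⟩
    induction h with
    | refl => exact .refl
    | tail _ h ih => exact .tail ih h
  · intro h
    induction h with
    | refl => exact ⟨0, .refl _⟩
    | tail _ h ih =>
      obtain ⟨t, ht⟩ := ih
      exact ⟨t + 1, .tail ht h⟩

/-- The string on the input tape when the input is `x`. -/
def tape (x : List A) : List (TapeSym A) :=
  TapeSym.left :: (x.map TapeSym.letter ++ [TapeSym.right])

/-- `M.Derives o s w r`: reading `w` without producing output, `M` gets from the state `o` to the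
state `r` and removes the string `s` from the stack; the state `none` stands for having accepted,
from where everything is read and removed. -/
inductive Derives (M : NPDA A B) :
    Option M.Q → List M.stackSym → List (TapeSym A) → Option M.Q → Prop
  | nil (o : Option M.Q) : Derives M o [] [] o
  | cons {o p r : Option M.Q} {Z : M.stackSym} {s : List M.stackSym} {w w' : List (TapeSym A)}
      (h : Derives M o [Z] w p) (h' : Derives M p s w' r) : Derives M o (Z :: s) (w ++ w') r
  | step {q q' : M.Q} {a : Option (TapeSym A)} {Z : M.stackSym} {u : List M.stackSym}
      {w : List (TapeSym A)} {r : Option M.Q} (hq : q ∉ M.halt) (h : (q', u, none) ∈ M.δ q a Z)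
      (h' : Derives M (some q') u w r) : Derives M (some q) [Z] (a.toList ++ w) r
  | acc {q : M.Q} (hq : q ∈ M.acc) (s : List M.stackSym) (w : List (TapeSym A)) :
      Derives M (some q) s w none
  | accepted (s : List M.stackSym) (w : List (TapeSym A)) : Derives M none s w none

theorem Derives.cons_inv {M : NPDA A B} {o r : Option M.Q} {Z : M.stackSym} {s : List M.stackSym}
    {w : List (TapeSym A)} (h : M.Derives o (Z :: s) w r) :
    ∃ p w₁ w₂, w = w₁ ++ w₂ ∧ M.Derives o [Z] w₁ p ∧ M.Derives p s w₂ r := by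
  cases h with
  | cons h h' => exact ⟨_, _, _, rfl, h, h'⟩
  | step hq h h' => exact ⟨_, _, _, (List.append_nil _).symm, .step hq h h', .nil _⟩
  | acc hq => exact ⟨none, w, [], (List.append_nil _).symm, .acc hq _ _, .accepted _ _⟩
  | accepted => exact ⟨none, w, [], (List.append_nil _).symm, .accepted _ _, .accepted _ _⟩

theorem Derives.append_inv {M : NPDA A B} {u : List M.stackSym} :
    ∀ {o r : Option M.Q} {s : List M.stackSym} {w : List (TapeSym A)}, M.Derives o (u ++ s) w r →
      ∃ p w₁ w₂, w = w₁ ++ w₂ ∧ M.Derives o u w₁ p ∧ M.Derives p s w₂ r := by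
  induction u with
  | nil => exact fun {o _ _ w} h => ⟨o, [], w, rfl, .nil o, h⟩
  | cons Z u ih =>
    intro o r s w h
    obtain ⟨p, w₁, w₂, rfl, h1, h2⟩ := h.cons_inv
    obtain ⟨p', w₃, w₄, rfl, h3, h4⟩ := ih h2
    exact ⟨p', w₁ ++ w₃, w₄, (List.append_assoc _ _ _).symm, .cons h1 h3, h4⟩

/-- The meaning of `Derives` in terms of computations. -/
def Realizes (M : NPDA A B) :
    Option M.Q → List M.stackSym → List (TapeSym A) → Option M.Q → Prop
  | none, _, _, r => r = none
  | some q, s, w, some q' => ∀ v st,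
      Relation.ReflTransGen M.Step ⟨q, w ++ v, s ++ st, []⟩ ⟨q', v, st, []⟩
  | some q, s, w, none => ∀ v st, ∃ d : M.Config,
      Relation.ReflTransGen M.Step ⟨q, w ++ v, s ++ st, []⟩ d ∧ d.state ∈ M.acc ∧ d.output = []

theorem Derives.realizes {M : NPDA A B} {o r : Option M.Q} {s : List M.stackSym}
    {w : List (TapeSym A)} (h : M.Derives o s w r) : M.Realizes o s w r := by
  induction h with
  | nil o =>
    cases o with
    | none => rfl
    | some q => exact fun v st => .refl
  | @cons o p r Z s w w' _ _ ih ih' =>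
    cases o with
    | none => cases ih; exact ih'
    | some q =>
      cases p with
      | none =>
        cases ih'
        intro v st
        simpa using ih (w' ++ v) (s ++ st)
      | some p =>
        cases r with
        | none =>
          intro v st
          obtain ⟨d, h1, h2⟩ := ih' v st
          exact ⟨d, .trans (by simpa using ih (w' ++ v) (s ++ st)) h1, h2⟩
        | some r =>
          intro v st
          exact .trans (by simpa using ih (w' ++ v) (s ++ st)) (ih' v st)
  | @step q q' a Z u w r hq h _ ih =>
    have hstep : ∀ v st, M.Step ⟨q, a.toList ++ w ++ v, [Z] ++ st, []⟩ ⟨q', w ++ v, u ++ st, []⟩ := by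
      intro v st
      cases a with
      | none => exact .lam hq h
      | some a => exact .read hq h
    cases r with
    | none =>
      intro v st
      obtain ⟨d, h1, h2⟩ := ih v st
      exact ⟨d, .head (hstep v st) h1, h2⟩
    | some r => exact fun v st => .head (hstep v st) (ih v st)
  | acc hq s w => exact fun v st => ⟨_, .refl, hq, rfl⟩
  | accepted => rfl

/-- The path is read backwards: each step undone becomes one use of `Derives.step`, and an empty
final output forces every step to be silent. -/
theorem Derives.of_stepsIn {M : NPDA A B} {t : ℕ} {c d : M.Config} (h : M.StepsIn t c d)
    (hd : M.Derives (some d.state) d.stack d.input none ∧ d.output = []) :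
    M.Derives (some c.state) c.stack c.input none ∧ c.output = [] := by
  induction h with
  | refl => exact hd
  | tail _ hs ih =>
    refine ih ?_
    obtain ⟨hd, ho⟩ := hd
    cases hs with
    | @read q q' a w Z s u o b hq h =>
      simp only [List.append_eq_nil_iff, Option.toList_eq_nil_iff] at ho
      obtain ⟨rfl, rfl⟩ := ho
      obtain ⟨p, w₁, w₂, rfl, h1, h2⟩ := Derives.append_inv hd
      exact ⟨.cons (.step hq h h1) h2, rfl⟩
    | @lam q q' w Z s u o b hq h =>
      simp only [List.append_eq_nil_iff, Option.toList_eq_nil_iff] at ho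
      obtain ⟨rfl, rfl⟩ := ho
      obtain ⟨p, w₁, w₂, rfl, h1, h2⟩ := Derives.append_inv hd
      exact ⟨.cons (w := [] ++ w₁) (.step hq h h1) h2, rfl⟩

theorem nil_mem_validOutputs_iff {M : NPDA A B} {x : List A} :
    [] ∈ M.validOutputs x ↔ M.Derives (some M.q₀) [M.Z₀] (tape x) none := by
  constructor
  · rintro ⟨t, d, h, hacc, ho⟩
    exact (Derives.of_stepsIn h ⟨.acc hacc _ _, ho⟩).1
  · intro h
    obtain ⟨d, h1, h2, h3⟩ := h.realizes [] []
    obtain ⟨t, ht⟩ := exists_stepsIn_iff.2 h1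
    refine ⟨t, d, ?_, h2, h3⟩
    simpa [init, tape] using ht

/-- Bounding the pushed strings is what keeps the set of grammar symbols finite. -/
theorem exists_length_le [Finite A] (M : NPDA A B) :
    ∃ l : ℕ, ∀ q a Z, ∀ e ∈ M.δ q a Z, e.2.1.length ≤ l := by
  have := M.finite_Q
  have := M.finite_stackSym
  obtain ⟨l, hl⟩ := (Set.finite_range fun c : M.Q × Option (TapeSym A) × M.stackSym =>
    (M.δ c.1 c.2.1 c.2.2).sup fun e => e.2.1.length).bddAbove
  exact ⟨l, fun q a Z e he => (Finset.le_sup (f := fun e => e.2.1.length) he).trans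
    (hl ⟨(q, a, Z), rfl⟩)⟩

/-- The symbols of the grammar of `M`: all words (`inl none`), at most one tape symbol, and the
triples of `Derives` with stack strings of length at most `l`. -/
abbrev GSym (M : NPDA A B) (l : ℕ) : Type :=
  Option (Option (TapeSym A)) ⊕
    (Option M.Q × {s : List M.stackSym // s.length ≤ l} × Option M.Q)

/-- The words derived from a symbol. -/
def GSym.Lang {M : NPDA A B} {l : ℕ} : M.GSym l → List (TapeSym A) → Prop
  | .inl none, _ => True
  | .inl (some a), w => w = a.toList
  | .inr (o, s, r), w => M.Derives o s w r

inductive TermRule (M : NPDA A B) (l : ℕ) : M.GSym l → List (TapeSym A) → Prop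
  | all : TermRule M l (.inl none) []
  | sym (a : Option (TapeSym A)) : TermRule M l (.inl (some a)) a.toList
  | nil (o : Option M.Q) {s} (hs : s.1 = []) : TermRule M l (.inr (o, s, o)) []

/-- The symbol `.inl (some none)` derives only the empty word; in the last two rules it is padding
that makes them binary. -/
inductive BinRule (M : NPDA A B) (l : ℕ) : M.GSym l → M.GSym l → M.GSym l → Prop
  | all (a : TapeSym A) : BinRule M l (.inl none) (.inl (some (some a))) (.inl none)
  | cons {o p r : Option M.Q} {Z : M.stackSym} {s s₁ s₂} (h : s.1 = Z :: s₂.1) (h₁ : s₁.1 = [Z]) :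
      BinRule M l (.inr (o, s, r)) (.inr (o, s₁, p)) (.inr (p, s₂, r))
  | step {q q' : M.Q} {a : Option (TapeSym A)} {Z : M.stackSym} {s u} {r : Option M.Q}
      (hs : s.1 = [Z]) (hq : q ∉ M.halt) (h : (q', u.1, none) ∈ M.δ q a Z) :
      BinRule M l (.inr (some q, s, r)) (.inl (some a)) (.inr (some q', u, r))
  | acc {q : M.Q} {s} (hq : q ∈ M.acc) :
      BinRule M l (.inr (some q, s, none)) (.inl none) (.inl (some none))
  | accepted {s} : BinRule M l (.inr (none, s, none)) (.inl none) (.inl (some none))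

theorem TermRule.lang {M : NPDA A B} {l : ℕ} {X : M.GSym l} {w : List (TapeSym A)}
    (h : M.TermRule l X w) : X.Lang w := by
  cases h with
  | all => trivial
  | sym a => rfl
  | nil o hs => rw [GSym.Lang, hs]; exact .nil o

theorem BinRule.lang {M : NPDA A B} {l : ℕ} {X Y Z : M.GSym l} {w w' : List (TapeSym A)}
    (h : M.BinRule l X Y Z) (hY : Y.Lang w) (hZ : Z.Lang w') : X.Lang (w ++ w') := by
  cases h with
  | all => trivial
  | cons h h₁ =>
    simp only [GSym.Lang, h, h₁] at *
    exact .cons hY hZ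
  | step hs hq h =>
    simp only [GSym.Lang, hs] at *
    subst hY
    exact .step hq h hZ
  | acc hq => exact .acc hq _ _
  | accepted => exact .accepted _ _

end NPDA

/-! ### Product with the automaton for sorted tapes -/

/-- One step of the automaton that accepts the tapes with sorted contents. -/
def phaseStep {n : ℕ} : TapeSym (Fin n) → Fin (n + 2) → Fin (n + 2) → Prop
  | .left, i, j => i.val = 0 ∧ j.val = 1
  | .letter a, i, j => 1 ≤ i.val ∧ i.val ≤ a.val + 1 ∧ j.val = a.val + 1
  | .right, i, j => 1 ≤ i.val ∧ i.val ≤ n ∧ j.val = n + 1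

/-- State 0 precedes the left endmarker, state `a + 1` allows only letters from `a` on, and state `n
+ 1` follows the right endmarker and has no successor. -/
def PhasePath {n : ℕ} : List (TapeSym (Fin n)) → Fin (n + 2) → Fin (n + 2) → Prop
  | [], i, j => i = j
  | a :: w, i, j => ∃ l, phaseStep a i l ∧ PhasePath w l j

theorem phasePath_append {n : ℕ} {w w' : List (TapeSym (Fin n))} {i j : Fin (n + 2)} :
    PhasePath (w ++ w') i j ↔ ∃ l, PhasePath w i l ∧ PhasePath w' l j := by
  induction w generalizing i with
  | nil => simp [PhasePath]
  | cons a w ih =>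
    simp only [List.cons_append, PhasePath, ih]
    constructor
    · rintro ⟨l, h, l', h', h''⟩; exact ⟨l', ⟨l, h, h'⟩, h''⟩
    · rintro ⟨l', ⟨l, h, h'⟩, h''⟩; exact ⟨l, h, l', h', h''⟩

/-- The contribution of a tape symbol to the Parikh vector. -/
def tapeWeight {n : ℕ} : TapeSym (Fin n) → Fin n → ℕ
  | .letter a => Pi.single a 1
  | _ => 0

theorem phasePath_sorted {n : ℕ} {x : List (Fin n)} {i : Fin (n + 2)} (h1 : 1 ≤ i.val)
    (hin : i.val ≤ n) (hx : x.Pairwise (· ≤ ·)) (hi : ∀ a ∈ x, i.val ≤ a.val + 1) :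
    PhasePath (x.map TapeSym.letter ++ [TapeSym.right]) i (Fin.last (n + 1)) := by
  induction x generalizing i with
  | nil => exact ⟨Fin.last (n + 1), ⟨h1, hin, rfl⟩, rfl⟩
  | cons a x ih =>
    obtain ⟨ha, hx⟩ := List.pairwise_cons.1 hx
    refine ⟨⟨a.val + 1, by omega⟩, ⟨h1, hi a (by simp), rfl⟩, ih ?_ ?_ hx ?_⟩
    · simp
    · simp only; omega
    · intro b hb
      have := Fin.le_def.1 (ha b hb)
      simp only; omega

theorem exists_sorted_of_phasePath {n : ℕ} {w : List (TapeSym (Fin n))} {i : Fin (n + 2)}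
    (h1 : 1 ≤ i.val) (hin : i.val ≤ n) (h : PhasePath w i (Fin.last (n + 1))) :
    ∃ x : List (Fin n), w = x.map TapeSym.letter ++ [TapeSym.right] ∧ x.Pairwise (· ≤ ·) ∧
      ∀ a ∈ x, i.val ≤ a.val + 1 := by
  induction w generalizing i with
  | nil =>
    simp only [PhasePath] at h
    subst h
    simp at hin
  | cons s w ih =>
    obtain ⟨l, hs, hw⟩ := h
    cases s with
    | left => have := hs.1; omega
    | letter a =>
      obtain ⟨-, h2, h3⟩ := hs
      obtain ⟨x, rfl, hx, hl⟩ := ih (by omega) (by omega) hw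
      refine ⟨a :: x, rfl, List.pairwise_cons.2 ⟨fun b hb => ?_, hx⟩, ?_⟩
      · have := hl b hb
        rw [Fin.le_def]; omega
      · intro b hb
        rcases List.mem_cons.1 hb with rfl | hb
        · exact h2
        · have := hl b hb; omega
    | right =>
      cases w with
      | nil => exact ⟨[], rfl, .nil, by simp⟩
      | cons s w =>
        obtain ⟨l', hs', -⟩ := hw
        have := hs.2.2
        cases s with
        | left => have := hs'.1; omega
        | letter a => have := hs'.2.1; omega
        | right => have := hs'.2.1; omega

theorem phasePath_zero_last_iff {n : ℕ} (hn : 0 < n) {w : List (TapeSym (Fin n))} :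
    PhasePath w 0 (Fin.last (n + 1)) ↔
      ∃ x : List (Fin n), x.Pairwise (· ≤ ·) ∧ w = NPDA.tape x := by
  constructor
  · intro h
    cases w with
    | nil => simp [PhasePath, Fin.ext_iff] at h
    | cons s w =>
      obtain ⟨l, hs, hw⟩ := h
      cases s with
      | left =>
        obtain ⟨x, rfl, hx, -⟩ := exists_sorted_of_phasePath (by have := hs.2; omega)
          (by have := hs.2; omega) hw
        exact ⟨x, hx, rfl⟩
      | letter a => have := hs.1; simp at this
      | right => have := hs.1; simp at this
  · rintro ⟨x, hx, rfl⟩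
    exact ⟨⟨1, by omega⟩, ⟨rfl, rfl⟩, phasePath_sorted le_rfl hn hx (by simp)⟩

theorem sum_tapeWeight_tape {n : ℕ} (x : List (Fin n)) :
    ((NPDA.tape x).map tapeWeight).sum = fun a => x.count a := by
  have : ((x.map TapeSym.letter).map tapeWeight).sum = fun a => x.count a := by
    induction x with
    | nil => rfl
    | cons b x ih =>
      simp only [List.map_cons, List.sum_cons, ih]
      funext a
      by_cases h : b = a
      · subst h; simp [tapeWeight, add_comm]
      · simp [tapeWeight, h, Ne.symm h]
  simp [NPDA.tape, tapeWeight] at this ⊢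
  exact this

namespace NPDA

open VTree

/-- The grammar for the silently accepted sorted words. -/
def grammar {n : ℕ} {B : Type} (M : NPDA (Fin n) B) (l : ℕ) :
    VecGrammar (M.GSym l × Fin (n + 2) × Fin (n + 2)) (Fin n) where
  leaf X v := ∃ w, w.length ≤ 1 ∧ M.TermRule l X.1 w ∧ PhasePath w X.2.1 X.2.2 ∧
    v = (w.map tapeWeight).sum
  bin X Y Z := M.BinRule l X.1 Y.1 Z.1 ∧ Y.2.1 = X.2.1 ∧ Z.2.1 = Y.2.2 ∧ Z.2.2 = X.2.2
  leaf_le := by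
    rintro X v ⟨w, hw, -, -, rfl⟩
    match w with
    | [] => simp
    | [.left] => simp [tapeWeight]
    | [.right] => simp [tapeWeight]
    | [.letter a] =>
      intro i
      by_cases h : i = a
      · subst h; simp [tapeWeight]
      · simp [tapeWeight, h]

variable {n : ℕ} {B : Type} {M : NPDA (Fin n) B} {l : ℕ}

theorem grammar_phases (M : NPDA (Fin n) B) (l : ℕ) :
    (M.grammar l).Phases (fun a => a.val + 1) (fun X => X.2.1.val) (fun X => X.2.2.val) where
  leaf := by
    rintro X v ⟨w, hw, -, h, rfl⟩
    match w with
    | [] => simp only [PhasePath] at h; simp [h]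
    | [.left] =>
      obtain ⟨l, hs, rfl⟩ := h
      have := hs.1
      simp [tapeWeight, this]
    | [.right] =>
      obtain ⟨l, hs, rfl⟩ := h
      have := hs.2
      simp only [tapeWeight, List.map_cons, List.map_nil, List.sum_cons, List.sum_nil]
      simp; omega
    | [.letter a] =>
      obtain ⟨l, hs, rfl⟩ := h
      refine ⟨by have := hs.2; omega, fun i hi => ?_⟩
      have : i = a := by
        by_contra h
        simp [tapeWeight, h] at hi
      subst this
      have := hs.2
      omega
  bin := by
    rintro X Y Z ⟨-, h1, h2, h3⟩
    exact ⟨by rw [h1], by rw [h2], by rw [h3]⟩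

theorem exists_word_of_valid {t : VTree (M.GSym l × Fin (n + 2) × Fin (n + 2)) (Fin n)}
    (ht : t.Valid (M.grammar l)) : ∃ w, t.root.1.Lang w ∧
      PhasePath w t.root.2.1 t.root.2.2 ∧ t.yield = (w.map tapeWeight).sum := by
  induction t with
  | leaf X v =>
    obtain ⟨w, -, hw, hp, rfl⟩ := ht
    exact ⟨w, hw.lang, hp, rfl⟩
  | node X a b iha ihb =>
    obtain ⟨⟨hr, h1, h2, h3⟩, ha, hb⟩ := ht
    obtain ⟨w, hw, hp, hy⟩ := iha ha
    obtain ⟨w', hw', hp', hy'⟩ := ihb hb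
    refine ⟨w ++ w', hr.lang hw hw', phasePath_append.2 ⟨a.root.2.2, ?_, ?_⟩, ?_⟩
    · rw [h1] at hp; exact hp
    · rw [h2, h3] at hp'; exact hp'
    · simp [yield, hy, hy']

/-- Some derivation tree with root `X` and states `i`, `j` corresponds to the word `w`. -/
def HasTree (M : NPDA (Fin n) B) (l : ℕ) (X : M.GSym l) (w : List (TapeSym (Fin n))) : Prop :=
  ∀ i j, PhasePath w i j → ∃ t : VTree (M.GSym l × Fin (n + 2) × Fin (n + 2)) (Fin n),
    t.Valid (M.grammar l) ∧ t.root = (X, i, j) ∧ t.yield = (w.map tapeWeight).sum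

theorem HasTree.of_termRule {X : M.GSym l} {w : List (TapeSym (Fin n))} (hw : w.length ≤ 1)
    (h : M.TermRule l X w) : M.HasTree l X w :=
  fun i j hp => ⟨.leaf (X, i, j) _, ⟨w, hw, h, hp, rfl⟩, rfl, rfl⟩

theorem HasTree.of_binRule {X Y Z : M.GSym l} {w w' : List (TapeSym (Fin n))}
    (h : M.BinRule l X Y Z) (hY : M.HasTree l Y w) (hZ : M.HasTree l Z w') :
    M.HasTree l X (w ++ w') := by
  intro i j hp
  obtain ⟨k, h1, h2⟩ := phasePath_append.1 hp
  obtain ⟨s, hs, hr, hy⟩ := hY i k h1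
  obtain ⟨t, ht, hr', hy'⟩ := hZ k j h2
  refine ⟨.node (X, i, j) s t, ⟨?_, hs, ht⟩, rfl, ?_⟩
  · rw [hr, hr']; exact ⟨h, rfl, rfl, rfl⟩
  · simp [yield, hy, hy']

theorem HasTree.sym (a : Option (TapeSym (Fin n))) : M.HasTree l (.inl (some a)) a.toList :=
  .of_termRule (by cases a <;> simp) (.sym a)

theorem HasTree.all (w : List (TapeSym (Fin n))) : M.HasTree l (.inl none) w := by
  induction w with
  | nil => exact .of_termRule (by simp) .all
  | cons a w ih => exact .of_binRule (.all a) (.sym (some a)) ih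

theorem HasTree.of_derives (hl : ∀ q a Z, ∀ e ∈ M.δ q a Z, e.2.1.length ≤ l)
    {o r : Option M.Q} {s : List M.stackSym} {w : List (TapeSym (Fin n))}
    (h : M.Derives o s w r) (hs : s.length ≤ l) : M.HasTree l (.inr (o, ⟨s, hs⟩, r)) w := by
  induction h with
  | nil o => exact .of_termRule (by simp) (.nil o rfl)
  | cons _ _ ih ih' =>
    simp only [List.length_cons] at hs
    exact .of_binRule (.cons rfl rfl) (ih (by simp; omega)) (ih' (by omega))
  | step hq h _ ih => exact .of_binRule (.step rfl hq h) (.sym _) (ih (hl _ _ _ _ h))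
  | acc hq s w =>
    rw [← List.append_nil w]
    exact .of_binRule (.acc hq) (.all w) (.sym none)
  | accepted s w =>
    rw [← List.append_nil w]
    exact .of_binRule .accepted (.all w) (.sym none)

/-- The Parikh vectors of the sorted words on which `M` produces the empty string form a finite
union of stratified linear sets. -/
theorem exists_linSets (hn : 0 < n) (M : NPDA (Fin n) B) :
    ∃ 𝓛 : Set ((Fin n → ℕ) × Finset (Fin n → ℕ)), 𝓛.Finite ∧ (∀ L ∈ 𝓛, Stratified L.2) ∧
      ∀ v, (∃ x : List (Fin n), x.Pairwise (· ≤ ·) ∧ (fun a => x.count a) = v ∧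
        [] ∈ M.validOutputs x) ↔ ∃ L ∈ 𝓛, v ∈ linSet L.1 L.2 := by
  have := M.finite_Q
  have := M.finite_stackSym
  obtain ⟨l, hl⟩ := M.exists_length_le
  -- The bound `l + 1` instead of `l` makes room for the initial stack `[M.Z₀]` even if `l = 0`.
  have hl' : ∀ q a Z, ∀ e ∈ M.δ q a Z, e.2.1.length ≤ l + 1 :=
    fun q a Z e he => (hl q a Z e he).trans (Nat.le_succ l)
  have : Finite {s : List M.stackSym // s.length ≤ l + 1} := List.finite_length_le _ _
  have hmono : StrictMono fun a : Fin n => a.val + 1 := fun a b h => Nat.succ_lt_succ h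
  let S : M.GSym (l + 1) := .inr (some M.q₀, ⟨[M.Z₀], by simp⟩, none)
  obtain ⟨𝓛, h1, h2, h3⟩ := (M.grammar_phases (l + 1)).exists_linSets hmono
    (S, 0, Fin.last (n + 1))
  refine ⟨𝓛, h1, h2, fun v => ?_⟩
  rw [← h3]
  constructor
  · rintro ⟨x, hx, rfl, ho⟩
    rw [← sum_tapeWeight_tape]
    exact HasTree.of_derives hl' (nil_mem_validOutputs_iff.1 ho) (by simp) _ _
      ((phasePath_zero_last_iff hn).2 ⟨x, hx, rfl⟩)
  · rintro ⟨t, ht, hr, rfl⟩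
    obtain ⟨w, hw, hp, hy⟩ := exists_word_of_valid ht
    rw [hr] at hw hp
    obtain ⟨x, hx, rfl⟩ := (phasePath_zero_last_iff hn).1 hp
    exact ⟨x, hx, by rw [hy, sum_tapeWeight_tape], nil_mem_validOutputs_iff.2 hw⟩

end NPDA

/-! ### Machines for the empty function and for unions -/

namespace NPDA

variable {A B : Type}

/-- The machine that rejects immediately. -/
def rejecting (A B : Type) : NPDA A B where
  Q := Unit
  stackSym := Unit
  finite_Q := inferInstance
  finite_stackSym := inferInstance
  δ _ _ _ := ∅
  q₀ := ()
  Z₀ := ()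
  acc := ∅
  rej := Set.univ
  disjoint_acc_rej := by simp

theorem rejecting_terminating : (rejecting A B).Terminating := by
  refine ⟨0, fun x t d h => ?_⟩
  have hstep : ∀ c e, ¬ (rejecting A B).Step c e := by
    intro c e h
    cases h with
    | read hq => exact hq (.inr trivial)
    | lam hq => exact hq (.inr trivial)
  refine ⟨?_, fun _ => .inr trivial⟩
  cases h with
  | refl => simp
  | tail _ hs => exact absurd hs (hstep _ _)

theorem rejecting_validOutputs (x : List A) : (rejecting A B).validOutputs x = ∅ := by
  rw [Set.eq_empty_iff_forall_notMem]
  rintro y ⟨t, d, -, h, -⟩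
  exact h

/-- The nondeterministic choice between the machines `M i`. -/
noncomputable def choice (M : Bool → NPDA A B) : NPDA A B where
  Q := Option (Σ i, (M i).Q)
  stackSym := Option (Σ i, (M i).stackSym)
  finite_Q := by
    have := fun i => (M i).finite_Q
    infer_instance
  finite_stackSym := by
    have := fun i => (M i).finite_stackSym
    infer_instance
  δ q a Z := match q, a, Z with
    | none, none, none =>
      ((Finset.univ : Finset Bool).finite_toSet.image fun i =>
        (some ⟨i, (M i).q₀⟩, [some ⟨i, (M i).Z₀⟩], none)).toFinset
    | some ⟨i, q⟩, a, some ⟨j, Z⟩ =>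
      if h : j = i then
        (((M i).δ q a (h ▸ Z)).finite_toSet.image fun e =>
          (some ⟨i, e.1⟩, e.2.1.map fun Y => some ⟨i, Y⟩, e.2.2)).toFinset
      else ∅
    | _, _, _ => ∅
  q₀ := none
  Z₀ := none
  acc := {q | ∃ i, ∃ q' ∈ (M i).acc, q = some ⟨i, q'⟩}
  rej := {q | ∃ i, ∃ q' ∈ (M i).rej, q = some ⟨i, q'⟩}
  disjoint_acc_rej := by
    rw [Set.disjoint_left]
    rintro _ ⟨i, q, hq, rfl⟩ ⟨j, q', hq', h⟩
    cases h
    exact Set.disjoint_left.1 (M i).disjoint_acc_rej hq hq'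

variable {M : Bool → NPDA A B}

/-- A state of `M i` as a state of the choice machine. -/
def choiceState (i : Bool) (q : (M i).Q) : (choice M).Q := some ⟨i, q⟩

/-- A stack symbol of `M i` as a stack symbol of the choice machine. -/
def choiceSym (i : Bool) (Z : (M i).stackSym) : (choice M).stackSym := some ⟨i, Z⟩

/-- A configuration of `M i` as a configuration of the choice machine. -/
def choiceConfig (i : Bool) (c : (M i).Config) : (choice M).Config :=
  ⟨choiceState i c.state, c.input, c.stack.map (choiceSym i), c.output⟩

theorem choiceState_mem_acc {i : Bool} {q : (M i).Q} :
    choiceState i q ∈ (choice M).acc ↔ q ∈ (M i).acc := by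
  constructor
  · rintro ⟨j, q, hq, h⟩
    cases h
    exact hq
  · exact fun h => ⟨i, _, h, rfl⟩

theorem choiceState_mem_halt {i : Bool} {q : (M i).Q} :
    choiceState i q ∈ (choice M).halt ↔ q ∈ (M i).halt := by
  constructor
  · rintro (⟨j, q, hq, h⟩ | ⟨j, q, hq, h⟩)
    · cases h; exact .inl hq
    · cases h; exact .inr hq
  · rintro (h | h)
    · exact .inl ⟨i, _, h, rfl⟩
    · exact .inr ⟨i, _, h, rfl⟩

theorem mem_choice_δ {i : Bool} {q : (M i).Q} {a : Option (TapeSym A)} {Z : (M i).stackSym}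
    {e : (choice M).Q × List (choice M).stackSym × Option B} :
    e ∈ (choice M).δ (choiceState i q) a (choiceSym i Z) ↔
      ∃ f ∈ (M i).δ q a Z, (choiceState i f.1, f.2.1.map (choiceSym i), f.2.2) = e := by
  have h : (choice M).δ (choiceState i q) a (choiceSym i Z) = _ := dif_pos rfl
  rw [h]
  exact Set.Finite.mem_toFinset _

theorem choice_step {i : Bool} {c : (M i).Config} {d : (choice M).Config} :
    (choice M).Step (choiceConfig i c) d ↔ ∃ e, (M i).Step c e ∧ d = choiceConfig i e := by
  constructor
  · obtain ⟨q, w, s, o⟩ := c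
    intro h
    cases s with
    | nil => cases h
    | cons Z s =>
      cases h with
      | read hq h =>
        obtain ⟨f, hf, h⟩ := mem_choice_δ.1 h
        cases h
        exact ⟨_, .read (mt choiceState_mem_halt.2 hq) hf, by simp [choiceConfig]⟩
      | lam hq h =>
        obtain ⟨f, hf, h⟩ := mem_choice_δ.1 h
        cases h
        exact ⟨_, .lam (mt choiceState_mem_halt.2 hq) hf, by simp [choiceConfig]⟩
  · rintro ⟨e, h, rfl⟩
    cases h with
    | read hq h =>
      simp only [choiceConfig, List.map_append, List.map_cons]
      exact .read (mt choiceState_mem_halt.1 hq) (mem_choice_δ.2 ⟨_, h, rfl⟩)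
    | lam hq h =>
      simp only [choiceConfig, List.map_append, List.map_cons]
      exact .lam (mt choiceState_mem_halt.1 hq) (mem_choice_δ.2 ⟨_, h, rfl⟩)

theorem choice_init_step {x : List A} {d : (choice M).Config} :
    (choice M).Step ((choice M).init x) d ↔ ∃ i, d = choiceConfig i ((M i).init x) := by
  constructor
  · intro h
    cases h with
    | read hq h => exact absurd h (Finset.notMem_empty _)
    | lam hq h =>
      obtain ⟨i, -, h⟩ := (Set.Finite.mem_toFinset _).1 h
      cases h
      exact ⟨i, rfl⟩
  · rintro ⟨i, rfl⟩
    have hq : (choice M).q₀ ∉ (choice M).halt := by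
      rintro (⟨i, q, -, h⟩ | ⟨i, q, -, h⟩) <;> cases h
    have h : (choiceState i (M i).q₀, [choiceSym i (M i).Z₀], none) ∈
        (choice M).δ (choice M).q₀ none (choice M).Z₀ :=
      (Set.Finite.mem_toFinset _).2 ⟨i, Finset.mem_coe.2 (Finset.mem_univ i), rfl⟩
    exact .lam hq h

theorem choice_stepsIn {x : List A} {t : ℕ} {d : (choice M).Config} :
    (choice M).StepsIn t ((choice M).init x) d ↔ (t = 0 ∧ d = (choice M).init x) ∨
      ∃ i s e, t = s + 1 ∧ (M i).StepsIn s ((M i).init x) e ∧ d = choiceConfig i e := by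
  constructor
  · intro h
    generalize hc : (choice M).init x = c at h
    induction h with
    | refl => exact .inl ⟨rfl, rfl⟩
    | tail _ hs ih =>
      right
      subst hc
      rcases ih rfl with ⟨rfl, rfl⟩ | ⟨i, s, e, rfl, h, rfl⟩
      · obtain ⟨i, rfl⟩ := choice_init_step.1 hs
        exact ⟨i, 0, _, rfl, .refl _, rfl⟩
      · obtain ⟨e', he, rfl⟩ := choice_step.1 hs
        exact ⟨i, s + 1, e', rfl, .tail h he, rfl⟩
  · rintro (⟨rfl, rfl⟩ | ⟨i, s, e, rfl, h, rfl⟩)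
    · exact .refl _
    · generalize hc : (M i).init x = c at h
      induction h with
      | refl => exact .tail (.refl _) (choice_init_step.2 ⟨i, by rw [hc]⟩)
      | tail _ hs ih => exact .tail (ih hc) (choice_step.2 ⟨_, hs, rfl⟩)

theorem choice_terminating (hM : ∀ i, (M i).Terminating) : (choice M).Terminating := by
  choose C hC using hM
  -- The sum dominates both constants, and the extra 1 pays for the choosing step.
  refine ⟨C true + C false + 1, fun x t d h => ?_⟩
  rcases choice_stepsIn.1 h with ⟨rfl, rfl⟩ | ⟨i, s, e, rfl, h', rfl⟩
  · exact ⟨Nat.zero_le _, fun h => absurd (choice_init_step.2 ⟨true, rfl⟩) (h _)⟩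
  · obtain ⟨h1, h2⟩ := hC i x s e h'
    refine ⟨?_, fun hd =>
      choiceState_mem_halt.2 (h2 fun f hf => hd _ (choice_step.2 ⟨f, hf, rfl⟩))⟩
    have : C i ≤ C true + C false := by cases i <;> omega
    have := Nat.mul_le_mul_right (x.length + 1) this
    rw [add_one_mul]
    omega

theorem choice_validOutputs (x : List A) :
    (choice M).validOutputs x = (M true).validOutputs x ∪ (M false).validOutputs x := by
  ext y
  constructor
  · rintro ⟨t, d, h, hacc, ho⟩
    rcases choice_stepsIn.1 h with ⟨rfl, rfl⟩ | ⟨i, s, e, rfl, h', rfl⟩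
    · obtain ⟨i, q, -, h⟩ := hacc; cases h
    · have := choiceState_mem_acc.1 hacc
      cases i
      · exact .inr ⟨s, e, h', this, ho⟩
      · exact .inl ⟨s, e, h', this, ho⟩
  · have : ∀ i, y ∈ (M i).validOutputs x → y ∈ (choice M).validOutputs x := by
      rintro i ⟨s, e, h, hacc, ho⟩
      exact ⟨s + 1, _, choice_stepsIn.2 (.inr ⟨i, s, e, rfl, h, rfl⟩),
        choiceState_mem_acc.2 hacc, ho⟩
    rintro (h | h)
    · exact this _ h
    · exact this _ h

/-! ### The machine comparing two letter counts -/

/-- The states of the machine that compares the numbers of occurrences of two letters. -/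
inductive CountState
  | run | acc | rej

/-- The machine that accepts with empty output if the letters `a` and `b` occur equally often: the
stack holds the letter in excess (`true` for `a`) as often as it exceeds, above the bottom symbol
`none`. -/
abbrev compare [DecidableEq A] (a b : A) : NPDA A B where
  Q := CountState
  stackSym := Option Bool
  finite_Q := Finite.of_injective (β := Fin 3)
    (fun s => match s with | .run => 0 | .acc => 1 | .rej => 2)
    (by intro s t h; cases s <;> cases t <;> simp_all)
  finite_stackSym := inferInstance
  δ q c Z := match q, c, Z with
    | .run, some (.letter c), Z =>
      if c = a then (if Z = some false then {(.run, [], none)} else {(.run, [some true, Z], none)})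
      else if c = b then
        (if Z = some true then {(.run, [], none)} else {(.run, [some false, Z], none)})
      else {(.run, [Z], none)}
    | .run, some .left, Z => {(.run, [Z], none)}
    | .run, some .right, Z => {(if Z = none then .acc else .rej, [Z], none)}
    | _, _, _ => ∅
  q₀ := .run
  Z₀ := none
  acc := {.acc}
  rej := {.rej}
  disjoint_acc_rej := by simp

/-- The stack of `compare` if the excess is `z`. -/
def excessStack : ℤ → List (Option Bool)
  | .ofNat n => List.replicate n (some true) ++ [none]
  | .negSucc n => List.replicate (n + 1) (some false) ++ [none]

theorem excessStack_zero : excessStack 0 = [none] := rfl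

theorem excessStack_add_one {z : ℤ} (hz : 0 ≤ z) :
    excessStack (z + 1) = some true :: excessStack z := by
  obtain ⟨n, rfl⟩ := Int.eq_ofNat_of_zero_le hz
  rfl

theorem excessStack_sub_one {z : ℤ} (hz : z ≤ 0) :
    excessStack (z - 1) = some false :: excessStack z := by
  obtain ⟨n, hn⟩ := Int.eq_ofNat_of_zero_le (neg_nonneg.2 hz)
  obtain rfl : z = -n := by omega
  have : -(n : ℤ) - 1 = Int.negSucc n := by omega
  rw [this]
  cases n with
  | zero => rfl
  | succ n => rfl

variable [DecidableEq A] {a b : A}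

theorem compare_step_iff {c : TapeSym A} {w : List (TapeSym A)} {Z : Option Bool}
    {s : List (Option Bool)} {o : List B} {d : (compare a b).Config} :
    (compare a b).Step ⟨.run, c :: w, Z :: s, o⟩ d ↔
      ∃ e ∈ (compare (B := B) a b).δ .run (some c) Z, d = ⟨e.1, w, e.2.1 ++ s, o ++ e.2.2.toList⟩ := by
  constructor
  · intro h
    cases h with
    | read hq h => exact ⟨_, h, rfl⟩
    | lam hq h => exact absurd h (Finset.notMem_empty _)
  · rintro ⟨e, he, rfl⟩
    refine .read ?_ he
    rintro (h | h) <;> cases h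

theorem compare_step_letter (hab : a ≠ b) {c : A} {w : List (TapeSym A)} {z : ℤ}
    {d : (compare (B := B) a b).Config} :
    (compare a b).Step ⟨.run, .letter c :: w, excessStack z, []⟩ d ↔
      d = ⟨.run, w, excessStack (z + [c].count a - [c].count b), []⟩ := by
  by_cases ha : c = a
  · subst ha
    have e : z + ([c].count c : ℕ) - ([c].count b : ℕ) = z + 1 := by simp [hab]
    rw [e]
    rcases lt_trichotomy z 0 with hz | rfl | hz
    · obtain ⟨y, rfl⟩ : ∃ y, z = y - 1 := ⟨z + 1, by ring⟩
      rw [excessStack_sub_one (by omega), compare_step_iff]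
      simp [compare]
    · rw [excessStack_add_one le_rfl, excessStack_zero, compare_step_iff]
      simp [compare]
    · rw [excessStack_add_one hz.le]
      obtain ⟨y, rfl⟩ : ∃ y, z = y + 1 := ⟨z - 1, by ring⟩
      rw [excessStack_add_one (by omega), compare_step_iff]
      simp [compare]
  by_cases hb : c = b
  · subst hb
    have e : z + ([c].count a : ℕ) - ([c].count c : ℕ) = z - 1 := by simp [Ne.symm hab]
    rw [e]
    rcases lt_trichotomy z 0 with hz | rfl | hz
    · rw [excessStack_sub_one hz.le]
      obtain ⟨y, rfl⟩ : ∃ y, z = y - 1 := ⟨z + 1, by ring⟩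
      rw [excessStack_sub_one (by omega), compare_step_iff]
      simp [compare, ha]
    · rw [excessStack_sub_one le_rfl, excessStack_zero, compare_step_iff]
      simp [compare, ha]
    · obtain ⟨y, rfl⟩ : ∃ y, z = y + 1 := ⟨z - 1, by ring⟩
      rw [excessStack_add_one (by omega), compare_step_iff]
      simp [compare, ha]
  · have e : z + ([c].count a : ℕ) - ([c].count b : ℕ) = z := by simp [ha, hb]
    rw [e]
    obtain ⟨Z, s, hs⟩ : ∃ Z s, excessStack z = Z :: s := by
      cases z with
      | ofNat n => cases n <;> exact ⟨_, _, rfl⟩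
      | negSucc n => exact ⟨_, _, rfl⟩
    rw [hs, compare_step_iff]
    simp [compare, ha, hb]

theorem compare_step_right {z : ℤ} {d : (compare (B := B) a b).Config} :
    (compare a b).Step ⟨.run, [.right], excessStack z, []⟩ d ↔
      d = ⟨if z = 0 then .acc else .rej, [], excessStack z, []⟩ := by
  rcases lt_trichotomy z 0 with hz | rfl | hz
  · rw [if_neg hz.ne]
    obtain ⟨y, rfl⟩ : ∃ y, z = y - 1 := ⟨z + 1, by ring⟩
    rw [excessStack_sub_one (by omega), compare_step_iff]
    simp [compare]
  · rw [if_pos rfl, excessStack_zero, compare_step_iff]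
    simp [compare]
  · rw [if_neg hz.ne']
    obtain ⟨y, rfl⟩ : ∃ y, z = y + 1 := ⟨z - 1, by ring⟩
    rw [excessStack_add_one (by omega), compare_step_iff]
    simp [compare]

theorem compare_step_init {x : List A} {d : (compare (B := B) a b).Config} :
    (compare a b).Step ((compare a b).init x) d ↔
      d = ⟨.run, x.map .letter ++ [.right], excessStack 0, []⟩ := by
  rw [excessStack_zero]
  refine compare_step_iff.trans ?_
  simp [compare]

/-- The configuration of `compare` after reading the letters `u`, with the letters `v` left. -/
def compareConfig (a b : A) (u v : List A) : (compare (B := B) a b).Config :=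
  ⟨.run, v.map .letter ++ [.right], excessStack (u.count a - u.count b), []⟩

/-- The last configuration of `compare`. -/
def compareFinal (a b : A) (x : List A) : (compare (B := B) a b).Config :=
  ⟨if x.count a = x.count b then .acc else .rej, [], excessStack (x.count a - x.count b), []⟩

theorem compareConfig_step_nil {u : List A} {d : (compare (B := B) a b).Config} :
    (compare a b).Step (compareConfig a b u []) d ↔ d = compareFinal a b u := by
  refine compare_step_right.trans ?_
  simp only [compareFinal, sub_eq_zero, Nat.cast_inj]

theorem compareConfig_step_cons (hab : a ≠ b) {u v : List A} {c : A}
    {d : (compare (B := B) a b).Config} :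
    (compare a b).Step (compareConfig a b u (c :: v)) d ↔ d = compareConfig a b (u ++ [c]) v := by
  refine (compare_step_letter hab).trans ?_
  simp only [compareConfig, List.count_append, Nat.cast_add]
  rw [show (u.count a : ℤ) - u.count b + [c].count a - [c].count b =
    u.count a + [c].count a - (u.count b + [c].count b) by ring]
  rfl

theorem compareFinal_not_step {x : List A} {d : (compare (B := B) a b).Config} :
    ¬ (compare a b).Step (compareFinal a b x) d := by
  have hq : (if x.count a = x.count b then .acc else .rej : CountState) ∈
      (compare (B := B) a b).halt := by
    split_ifs
    · exact .inl rfl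
    · exact .inr rfl
  generalize hc : (compareFinal a b x : (compare (B := B) a b).Config) = c
  intro h
  cases h with
  | read hq' => cases hc
  | lam hq' =>
    have := congrArg Config.state hc
    simp only [compareFinal] at this
    exact hq' (this ▸ hq)

theorem compare_stepsIn (hab : a ≠ b) {x : List A} {t : ℕ} {d : (compare (B := B) a b).Config}
    (h : (compare a b).StepsIn t ((compare a b).init x) d) :
    (t = 0 ∧ d = (compare a b).init x) ∨
      (∃ u v, x = u ++ v ∧ t = u.length + 1 ∧ d = compareConfig a b u v) ∨
      (t = x.length + 2 ∧ d = compareFinal a b x) := by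
  generalize hc : (compare a b).init x = c at h
  induction h with
  | refl => exact .inl ⟨rfl, rfl⟩
  | tail _ hs ih =>
    subst hc
    rcases ih rfl with ⟨rfl, rfl⟩ | ⟨u, v, rfl, rfl, rfl⟩ | ⟨rfl, rfl⟩
    · exact .inr (.inl ⟨[], x, rfl, rfl, compare_step_init.1 hs⟩)
    · cases v with
      | nil =>
        right; right
        exact ⟨by simp, by rw [List.append_nil]; exact compareConfig_step_nil.1 hs⟩
      | cons c v =>
        right; left
        exact ⟨u ++ [c], v, by simp, by simp, (compareConfig_step_cons hab).1 hs⟩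
    · exact absurd hs compareFinal_not_step

theorem compare_stepsIn_config (hab : a ≠ b) (u v : List A) :
    (compare (B := B) a b).StepsIn (u.length + 1) ((compare a b).init (u ++ v))
      (compareConfig a b u v) := by
  induction u using List.reverseRecOn generalizing v with
  | nil => exact .tail (.refl _) (compare_step_init.2 rfl)
  | append_singleton u c ih =>
    have := ih (c :: v)
    rw [List.append_assoc, List.length_append]
    exact .tail this ((compareConfig_step_cons hab).2 rfl)

theorem compare_terminating (hab : a ≠ b) : (compare (B := B) a b).Terminating := by
  -- A full run takes `x.length + 2` steps: one for each letter and one for each endmarker.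
  refine ⟨2, fun x t d h => ?_⟩
  rcases compare_stepsIn hab h with ⟨rfl, rfl⟩ | ⟨u, v, rfl, rfl, rfl⟩ | ⟨rfl, rfl⟩
  · exact ⟨Nat.zero_le _, fun h => absurd (compare_step_init.2 rfl) (h _)⟩
  · refine ⟨by simp; omega, fun h => ?_⟩
    cases v with
    | nil => exact absurd (compareConfig_step_nil.2 rfl) (h _)
    | cons c v => exact absurd ((compareConfig_step_cons hab).2 rfl) (h _)
  · refine ⟨by omega, fun _ => ?_⟩
    simp only [compareFinal]
    split_ifs
    · exact .inl rfl
    · exact .inr rfl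

theorem compare_validOutputs (hab : a ≠ b) (x : List A) :
    (compare (B := B) a b).validOutputs x = {y | y = [] ∧ x.count a = x.count b} := by
  ext y
  constructor
  · rintro ⟨t, d, h, hacc, rfl⟩
    rcases compare_stepsIn hab h with ⟨rfl, rfl⟩ | ⟨u, v, rfl, rfl, rfl⟩ | ⟨rfl, rfl⟩
    · cases hacc
    · cases hacc
    · refine ⟨rfl, ?_⟩
      by_contra hne
      simp only [compareFinal, if_neg hne] at hacc
      cases hacc
  · rintro ⟨rfl, hx⟩
    have := compare_stepsIn_config (B := B) hab x []
    rw [List.append_nil] at this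
    refine ⟨_, _, .tail this (compareConfig_step_nil.2 rfl), ?_, rfl⟩
    simp only [compareFinal, if_pos hx]
    rfl

end NPDA

/-! ### Algebra of conjunctive classes -/

namespace FunClass

variable {F G : FunClass} {A B : Type} [Finite A] [Nonempty A] [Finite B] [Nonempty B]
  {f : List A → Set (List B)} {k m : ℕ}

theorem mem_conj_succ : f ∈ F.conj (k + 1) A B ↔
    ∃ g : Fin (k + 1) → List A → Set (List B), (∀ i, g i ∈ F A B) ∧ ∀ x, f x = ⋂ i, g i x := by
  induction k generalizing f with
  | zero =>
    constructor
    · exact fun h => ⟨fun _ => f, fun _ => h, fun x => (Set.iInter_const _).symm⟩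
    · rintro ⟨g, hg, h⟩
      have : f = g 0 := funext fun x => (h x).trans (ciInf_unique (ι := Fin 1) (s := fun i => g i x))
      rw [this]; exact hg 0
  | succ k ih =>
    constructor
    · rintro ⟨f₁, h₁, f₂, h₂, h⟩
      obtain ⟨g, hg, hx⟩ := ih.1 h₁
      refine ⟨Fin.snoc g f₂, fun i => ?_, fun x => ?_⟩
      · refine Fin.lastCases ?_ (fun i => ?_) i
        · simpa using h₂
        · simpa using hg i
      · ext y
        simp [h x, hx x, Fin.forall_fin_succ']
    · rintro ⟨g, hg, h⟩
      refine ⟨fun x => ⋂ i : Fin (k + 1), g i.castSucc x,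
        ih.2 ⟨_, fun i => hg i.castSucc, fun _ => rfl⟩, g (Fin.last _), hg _, fun x => ?_⟩
      ext y
      simp [h x, Fin.forall_fin_succ']

/-- The functions of `F(k)` are the intersections of families of `k` functions of `F`. -/
theorem mem_conj_iff {ι : Type} [Finite ι] [Nonempty ι] (hι : Nat.card ι = k) :
    f ∈ F.conj k A B ↔
      ∃ g : ι → List A → Set (List B), (∀ i, g i ∈ F A B) ∧ ∀ x, f x = ⋂ i, g i x := by
  obtain ⟨k, rfl⟩ : ∃ l, k = l + 1 :=
    Nat.exists_eq_succ_of_ne_zero (by rw [← hι]; exact Nat.card_pos.ne')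
  let e : ι ≃ Fin (k + 1) := Finite.equivFinOfCardEq hι
  rw [mem_conj_succ]
  constructor
  · rintro ⟨g, hg, h⟩
    exact ⟨g ∘ e, fun i => hg _, fun x => by rw [h x]; exact (e.iInf_comp (g := fun i => g i x)).symm⟩
  · rintro ⟨g, hg, h⟩
    exact ⟨g ∘ e.symm, fun i => hg _,
      fun x => by rw [h x]; exact (e.symm.iInf_comp (g := fun i => g i x)).symm⟩

theorem mem_conj_fin (hk : 1 ≤ k) : f ∈ F.conj k A B ↔
    ∃ g : Fin k → List A → Set (List B), (∀ i, g i ∈ F A B) ∧ ∀ x, f x = ⋂ i, g i x :=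
  have : Nonempty (Fin k) := ⟨⟨0, hk⟩⟩
  mem_conj_iff (Nat.card_fin k)

theorem conj_wedge_subset (hk : 1 ≤ k) (hm : 1 ≤ m) :
    (F.conj k).wedge (F.conj m) ⊆ F.conj (k + m) := by
  rintro A B _ _ _ _ f ⟨f₁, h₁, f₂, h₂, h⟩
  obtain ⟨g₁, hg₁, h₁⟩ := (mem_conj_fin hk).1 h₁
  obtain ⟨g₂, hg₂, h₂⟩ := (mem_conj_fin hm).1 h₂
  have : Nonempty (Fin k) := ⟨⟨0, hk⟩⟩
  refine (mem_conj_iff (ι := Fin k ⊕ Fin m) (by simp)).2 ⟨Sum.elim g₁ g₂, ?_, fun x => ?_⟩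
  · rintro (i | i)
    · exact hg₁ i
    · exact hg₂ i
  · rw [h x, h₁ x, h₂ x]
    ext y
    simp

/-- Union distributes over the two intersections, giving one binary union for each pair of indices.
-/
theorem conj_vee_subset (hF : F.vee F ⊆ F) (hk : 1 ≤ k) (hm : 1 ≤ m) :
    (F.conj k).vee (F.conj m) ⊆ F.conj (k * m) := by
  rintro A B _ _ _ _ f ⟨f₁, h₁, f₂, h₂, h⟩
  obtain ⟨g₁, hg₁, h₁⟩ := (mem_conj_fin hk).1 h₁
  obtain ⟨g₂, hg₂, h₂⟩ := (mem_conj_fin hm).1 h₂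
  have : Nonempty (Fin k) := ⟨⟨0, hk⟩⟩
  have : Nonempty (Fin m) := ⟨⟨0, hm⟩⟩
  refine (mem_conj_iff (ι := Fin k × Fin m) (by simp)).2
    ⟨fun i x => g₁ i.1 x ∪ g₂ i.2 x, fun i => ?_, fun x => ?_⟩
  · exact hF A B _ ⟨_, hg₁ i.1, _, hg₂ i.2, fun _ => rfl⟩
  · rw [h x, h₁ x, h₂ x]
    ext y
    simp only [Set.mem_union, Set.mem_iInter, Prod.forall]
    constructor
    · rintro (h | h) i j
      · exact .inl (h i)
      · exact .inr (h j)
    · intro h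
      by_contra! hne
      obtain ⟨⟨i, hi⟩, j, hj⟩ := hne
      exact (h i j).elim hi hj

/-- A conjunctive class contains the base class. -/
theorem mem_conj_of_mem (hk : 1 ≤ k) (hf : f ∈ F A B) : f ∈ F.conj k A B :=
  have : Nonempty (Fin k) := ⟨⟨0, hk⟩⟩
  (mem_conj_fin hk).2 ⟨fun _ => f, fun _ => hf, fun _ => (Set.iInter_const _).symm⟩

/-- This supplies a factor that changes nothing in an intersection. The constant function whose
value is the set of all strings cannot serve for `baseCFLMV`, since linear running time bounds the
length of the outputs. -/
theorem exists_mem_superset (hk : 1 ≤ k) (hf : f ∈ F.conj k A B) :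
    ∃ g ∈ F A B, ∀ x, f x ⊆ g x := by
  obtain ⟨g, hg, h⟩ := (mem_conj_fin hk).1 hf
  exact ⟨g ⟨0, hk⟩, hg _, fun x => by rw [h x]; exact Set.iInter_subset _ _⟩

theorem conj_max_subset_wedge (hk : 1 ≤ k) (hm : 1 ≤ m) :
    F.conj (max k m) ⊆ (F.conj k).wedge (F.conj m) := by
  intro A B _ _ _ _ f hf
  obtain ⟨g, hg, h⟩ := exists_mem_superset (hk.trans (le_max_left k m)) hf
  rcases le_total m k with hkm | hkm
  · rw [max_eq_left hkm] at hf
    exact ⟨f, hf, g, mem_conj_of_mem hm hg, fun x => (Set.inter_eq_left.2 (h x)).symm⟩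
  · rw [max_eq_right hkm] at hf
    exact ⟨g, mem_conj_of_mem hk hg, f, hf, fun x => (Set.inter_eq_right.2 (h x)).symm⟩

theorem conj_max_subset_vee (hF : ∀ (A B : Type) [Finite A] [Nonempty A] [Finite B] [Nonempty B],
    (fun _ => ∅) ∈ F A B) (hk : 1 ≤ k) (hm : 1 ≤ m) :
    F.conj (max k m) ⊆ (F.conj k).vee (F.conj m) := by
  intro A B _ _ _ _ f hf
  rcases le_total m k with hkm | hkm
  · rw [max_eq_left hkm] at hf
    exact ⟨f, hf, _, mem_conj_of_mem hm (hF A B), fun x => (Set.union_empty _).symm⟩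
  · rw [max_eq_right hkm] at hf
    exact ⟨_, mem_conj_of_mem hk (hF A B), f, hf, fun x => (Set.empty_union _).symm⟩

theorem conj_subset_conj_succ (hk : 1 ≤ k) : F.conj k ⊆ F.conj (k + 1) := by
  intro A B _ _ _ _ f hf
  obtain ⟨g, hg, h⟩ := exists_mem_superset hk hf
  obtain ⟨k, rfl⟩ := Nat.exists_eq_add_of_le' hk
  exact ⟨f, hf, g, hg, fun x => (Set.inter_eq_left.2 (h x)).symm⟩

end FunClass

/-! ### The separating function and the main theorem -/

theorem empty_mem_baseCFLMV (A B : Type) [Finite A] [Nonempty A] [Finite B] [Nonempty B] :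
    (fun _ => ∅) ∈ baseCFLMV A B :=
  ⟨.rejecting A B, NPDA.rejecting_terminating, fun x => (NPDA.rejecting_validOutputs x).symm⟩

theorem baseCFLMV_vee_subset : baseCFLMV.vee baseCFLMV ⊆ baseCFLMV := by
  rintro A B _ _ _ _ f ⟨f₁, ⟨M₁, h₁, e₁⟩, f₂, ⟨M₂, h₂, e₂⟩, h⟩
  refine ⟨.choice fun i => cond i M₁ M₂, NPDA.choice_terminating (Bool.rec h₂ h₁), fun x => ?_⟩
  rw [h x, e₁ x, e₂ x, NPDA.choice_validOutputs]
  rfl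

/-- The function that is defined, with the empty string as value, on the words in which the `i`-th
letter of the first half of the alphabet occurs as often as the `i`-th letter of the second half,
for all `i`. -/
def balance (m : ℕ) (x : List (Fin (m + m))) : Set (List Unit) :=
  {y | y = [] ∧ ∀ i : Fin m, x.count (Fin.castAdd m i) = x.count (Fin.natAdd m i)}

theorem balance_mem_CFLSV (k : ℕ) : balance (k + 1) ∈ CFLSV (k + 1) _ _ := by
  refine FunClass.mem_conj_succ.2 ⟨fun i x => {y | y = [] ∧
    x.count (Fin.castAdd (k + 1) i) = x.count (Fin.natAdd (k + 1) i)}, fun i => ⟨?_, ?_⟩, ?_⟩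
  · have hne : Fin.castAdd (k + 1) i ≠ Fin.natAdd (k + 1) i := by
      intro h
      have := congrArg Fin.val h
      simp only [Fin.val_castAdd, Fin.val_natAdd] at this
      omega
    exact ⟨_, NPDA.compare_terminating hne, fun x => (NPDA.compare_validOutputs hne x).symm⟩
  · rintro x y ⟨rfl, -⟩ z ⟨rfl, -⟩
    rfl
  · intro x
    ext y
    simp [balance, forall_and]

theorem balance_notMem_CFLSV {k : ℕ} (hk : 1 ≤ k) : balance (k + 1) ∉ CFLSV k _ _ := by
  intro h
  obtain ⟨g, hg, hx⟩ := (FunClass.mem_conj_fin hk).1 h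
  choose M _ hM using fun j => (hg j).1
  have hmem : ∀ x, (∀ j, [] ∈ (M j).validOutputs x) ↔
      ∀ i, x.count (Fin.castAdd (k + 1) i) = x.count (Fin.natAdd (k + 1) i) := by
    intro x
    have : [] ∈ balance (k + 1) x ↔ ∀ j, [] ∈ (M j).validOutputs x := by
      rw [hx x, Set.mem_iInter]
      simp only [hM]
    rw [← this]
    simp [balance]
  choose 𝓛 hfin hstrat h𝓛 using fun j => (M j).exists_linSets (n := k + 1 + (k + 1)) (by omega)
  have hdiag : ∀ L : Fin k → (Fin (k + 1 + (k + 1)) → ℕ) × Finset (Fin (k + 1 + (k + 1)) → ℕ),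
      (∀ j, L j ∈ 𝓛 j) → ∀ z, (∀ j, z ∈ linSet (L j).1 (L j).2) →
      ∀ i : Fin (k + 1), z (Fin.castAdd (k + 1) i) = z (Fin.natAdd (k + 1) i) := by
    intro L hL z hz
    choose x hs hc ho using fun j => (h𝓛 j z).2 ⟨L j, hL j, hz j⟩
    -- Each machine provides its own word with vector `z`; sorted words with equal letter counts
    -- coincide, so all machines output the empty string on one word.
    have heq : ∀ j, x j = x ⟨0, hk⟩ := fun j =>
      List.Perm.eq_of_pairwise (fun a b _ _ => le_antisymm) (hs j) (hs _)
        (List.perm_iff_count.2 fun a => by rw [congrFun (hc j) a, congrFun (hc _) a])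
    have := (hmem (x ⟨0, hk⟩)).1 fun j => by rw [← heq j]; exact ho j
    intro i
    rw [← hc ⟨0, hk⟩]
    exact this i
  -- The sorted word with vector `momentPoint (k + 1) t` is balanced, so for every `t` some choice
  -- of linear sets contains that vector.
  have hcover : (Set.univ : Set ℕ) ⊆ ⋃ L ∈ Set.univ.pi 𝓛,
      {t : ℕ | ∀ j, momentPoint (k + 1) t ∈ linSet (L j).1 (L j).2} := by
    intro t _
    obtain ⟨x, hs, hc⟩ : ∃ x : List (Fin (k + 1 + (k + 1))), x.Pairwise (· ≤ ·) ∧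
        (fun a => x.count a) = momentPoint (k + 1) t := by
      let s : Multiset (Fin (k + 1 + (k + 1))) := ∑ a, Multiset.replicate (momentPoint (k + 1) t a) a
      refine ⟨s.sort (· ≤ ·), s.pairwise_sort _, ?_⟩
      funext a
      rw [← Multiset.coe_count, Multiset.sort_eq]
      simp [s, Multiset.count_sum', Multiset.count_replicate]
    have ho := (hmem x).2 fun i => by
      have h1 := congrFun hc (Fin.castAdd (k + 1) i)
      have h2 := congrFun hc (Fin.natAdd (k + 1) i)
      simp only [momentPoint, Fin.append_left, Fin.append_right] at h1 h2
      rw [h1, h2]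
    choose L hL hm using fun j => (h𝓛 j (momentPoint (k + 1) t)).1 ⟨x, hs, hc, ho j⟩
    exact Set.mem_iUnion₂.2 ⟨L, fun j _ => hL j, hm⟩
  refine Set.infinite_univ (Set.Finite.subset ?_ hcover)
  refine Set.Finite.biUnion (Set.Finite.pi fun j => hfin j) fun L hL => ?_
  exact finite_setOf_momentPoint_mem hk _ _ _ rfl (fun j => hstrat j _ (hL j trivial))
    (hdiag L fun j => hL j trivial)

theorem mainTheorem7 (k m : ℕ) (hk : 1 ≤ k) (hm : 1 ≤ m) :
    (CFLMV (max k m) ⊆ (CFLMV k).vee (CFLMV m) ∧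
      (CFLMV k).vee (CFLMV m) ⊆ CFLMV (k * m)) ∧
    (CFLMV (max k m) ⊆ (CFLMV k).wedge (CFLMV m) ∧
      (CFLMV k).wedge (CFLMV m) ⊆ CFLMV (k + m)) ∧
    CFLSV k ⊂ CFLSV (k + 1) := by
  refine ⟨⟨FunClass.conj_max_subset_vee (fun A B _ _ _ _ => empty_mem_baseCFLMV A B) hk hm,
    FunClass.conj_vee_subset baseCFLMV_vee_subset hk hm⟩,
    ⟨FunClass.conj_max_subset_wedge hk hm, FunClass.conj_wedge_subset hk hm⟩,
    FunClass.conj_subset_conj_succ hk, ?_⟩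
  exact ⟨_, _, inferInstance, inferInstance, inferInstance, inferInstance, balance (k + 1),
    balance_mem_CFLSV k, balance_notMem_CFLSV hk⟩
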